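/- Let $N\ge 2$, $1<p<\infty$, and let $F:\mathbb R^N\to[0,+\infty[$ be a convex function such that $F(t\xi)=|t|F(\xi)$ for all $t\in\mathbb R$, $\xi\in\mathbb R^N$, and $F(\xi)\ge a|\xi|$ for some constant $a>0$. Assume that $F\in C^{3,\alpha}(\mathbb R^N\setminus\{0\})$ for some $\alpha\in(0,1)$ (the third derivatives being locally $\alpha$-Hölder continuous in $\mathbb R^N\setminus\{0\}$), and that the Hessian matrix $\nabla^2_\xi[F^p](\xi)$ is positive definite for every $\xi\ne 0$. Let $\Omega\subset\mathbb R^N$ be a bounded $C^2$ domain, that is, a nonempty, connected, bounded open set with $C^2$ boundary, and let $\nu_\Omega$ be its Euclidean outer unit normal. Suppose that the anisotropic mean curvature $\mathcal H_F(y)$ is nonnegative at every $y\in\partial\Omega$, where $\mathcal H_F(y)$ is the sum of the eigenvalues (the trace) of the differential $dn^F_\Omega(y)$, restricted to the tangent space $T_y\partial\Omega$, of the anisotropic outer normal $n^F_\Omega=\nabla F(\nu_\Omega)$ on $\partial\Omega$. Let $\beta<0$ and let $$ \lambda_1(\beta,\Omega)=\inf_{\psi\in W^{1,p}(\Omega)\setminus\{0\}}\frac{\displaystyle\int_\Omega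 F(\nabla\psi)^p\,dx+\beta\int_{\partial\Omega}|\psi|^pF(\nu_\Omega)\,d\mathcal H^{N-1}}{\displaystyle\int_\Omega|\psi|^p\,dx} $$ be the first eigenvalue of the Robin problem for the anisotropic $p$-Laplacian, where the values of $\psi$ on $\partial\Omega$ are taken in the sense of traces. Then $$ \lambda_1(\beta,\Omega)\le(1-p)\,|\beta|^{\frac{p}{p-1}}. $$ -/

import Mathlib

noncomputable section

namespace RobinFinsler

open MeasureTheory Set Filter Topology
open scoped ENNReal NNReal ContDiff RealInnerProductSpace

/-- The standing assumptions on the Finsler norm `F` of `ℝ^N`: convex, absolutely `1`-homogeneous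
(hence even), coercive, of class `C^{3,α}` away from the origin for some `α ∈ (0,1)` (the third
derivative is locally `α`-Hölder continuous there), and such that the Hessian of `F ^ p` is positive
definite away from the origin. -/
structure IsFinslerNorm {N : ℕ} (p : ℝ) (F : EuclideanSpace ℝ (Fin N) → ℝ) : Prop where
  convex : ConvexOn ℝ univ F
  homogeneous : ∀ (t : ℝ) (ξ : EuclideanSpace ℝ (Fin N)), F (t • ξ) = |t| * F ξ
  coercive : ∃ a : ℝ, 0 < a ∧ ∀ ξ, a * ‖ξ‖ ≤ F ξ
  contDiffOn : ContDiffOn ℝ 3 F {0}ᶜ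
  holder : ∃ α : ℝ≥0, 0 < α ∧ α < 1 ∧ ∀ ξ : EuclideanSpace ℝ (Fin N), ξ ≠ 0 →
    ∃ U ∈ 𝓝 ξ, ∃ C : ℝ≥0, HolderOnWith C α (iteratedFDeriv ℝ 3 F) U
  hessian_pos : ∀ ξ : EuclideanSpace ℝ (Fin N), ξ ≠ 0 → ∀ v : EuclideanSpace ℝ (Fin N), v ≠ 0 →
    0 < fderiv ℝ (fderiv ℝ (fun η => F η ^ p)) ξ v v

/-- The boundary of `Ω` is of class `C²`: near each boundary point, in suitable orthonormal
coordinates with last axis spanned by the unit vector `e`, the set `Ω` is the region above the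
graph of a `C²` function `γ`. Only the values of `γ` on the hyperplane orthogonal to `e` matter. -/
def HasC2Boundary {N : ℕ} (Ω : Set (EuclideanSpace ℝ (Fin N))) : Prop :=
  ∀ y ∈ frontier Ω, ∃ e : EuclideanSpace ℝ (Fin N), ‖e‖ = 1 ∧
    ∃ γ : EuclideanSpace ℝ (Fin N) → ℝ, ContDiff ℝ 2 γ ∧
      ∃ r : ℝ, 0 < r ∧ ∀ x ∈ Metric.ball y r, x ∈ Ω ↔ γ (x - ⟪e, x⟫ • e) < ⟪e, x⟫

/-- A bounded `C²` domain: a (nonempty) connected bounded open set with `C²` boundary. -/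
structure IsBoundedC2Domain {N : ℕ} (Ω : Set (EuclideanSpace ℝ (Fin N))) : Prop where
  isOpen : IsOpen Ω
  isConnected : IsConnected Ω
  isBounded : Bornology.IsBounded Ω
  boundary : HasC2Boundary Ω

/-- `ν` is the outer unit normal to `Ω` at `y`: every direction `v` with `ν · v < 0` points into
`Ω`, and every direction with `ν · v > 0` points to the exterior. At a boundary point of a `C²`
domain there is exactly one such vector. -/
def IsOuterUnitNormal {N : ℕ} (Ω : Set (EuclideanSpace ℝ (Fin N)))
    (y ν : EuclideanSpace ℝ (Fin N)) : Prop :=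
  ‖ν‖ = 1 ∧ (∀ v, ⟪ν, v⟫ < 0 → ∀ᶠ t : ℝ in 𝓝[>] 0, y + t • v ∈ Ω) ∧
    (∀ v, 0 < ⟪ν, v⟫ → ∀ᶠ t : ℝ in 𝓝[>] 0, y + t • v ∉ closure Ω)

open Classical in
/-- The Euclidean outer normal `ν_Ω` (junk value `0` where there is none). -/
def outerNormal {N : ℕ} (Ω : Set (EuclideanSpace ℝ (Fin N))) (y : EuclideanSpace ℝ (Fin N)) :
    EuclideanSpace ℝ (Fin N) :=
  if h : ∃ ν, IsOuterUnitNormal Ω y ν then h.choose else 0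

/-- The anisotropic outer normal `n^F_Ω = F_ξ(ν_Ω)`. -/
def anisotropicNormal {N : ℕ} (F : EuclideanSpace ℝ (Fin N) → ℝ)
    (Ω : Set (EuclideanSpace ℝ (Fin N))) (y : EuclideanSpace ℝ (Fin N)) :
    EuclideanSpace ℝ (Fin N) :=
  gradient F (outerNormal Ω y)

/-- The tangent space `T_y ∂Ω`, the hyperplane orthogonal to `ν_Ω(y)`. -/
def tangentHyperplane {N : ℕ} (Ω : Set (EuclideanSpace ℝ (Fin N)))
    (y : EuclideanSpace ℝ (Fin N)) : Submodule ℝ (EuclideanSpace ℝ (Fin N)) :=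
  (Submodule.span ℝ {outerNormal Ω y})ᗮ

/-- The anisotropic Weingarten map, the differential of `n^F_Ω : ∂Ω → ∂𝒲` at `y`. The tangent space
of the Wulff shape at `n^F_Ω(y)` is the same hyperplane `T_y ∂Ω`, so that this is an endomorphism of
`T_y ∂Ω`; the orthogonal projection only serves to express this in the type. The derivative within
`∂Ω` is determined on `T_y ∂Ω`, which is where it is used. -/
def weingartenMap {N : ℕ} (F : EuclideanSpace ℝ (Fin N) → ℝ)
    (Ω : Set (EuclideanSpace ℝ (Fin N))) (y : EuclideanSpace ℝ (Fin N)) :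
    tangentHyperplane Ω y →L[ℝ] tangentHyperplane Ω y :=
  (tangentHyperplane Ω y).orthogonalProjectionOnto ∘L
    (fderivWithin ℝ (anisotropicNormal F Ω) (frontier Ω) y ∘L (tangentHyperplane Ω y).subtypeL)

/-- The anisotropic mean curvature `ℋ_F(y)`: the sum of the anisotropic principal curvatures, the
eigenvalues of the anisotropic Weingarten map, that is, its trace. -/
def anisotropicMeanCurvature {N : ℕ} (F : EuclideanSpace ℝ (Fin N) → ℝ)
    (Ω : Set (EuclideanSpace ℝ (Fin N))) (y : EuclideanSpace ℝ (Fin N)) : ℝ :=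
  LinearMap.trace ℝ (tangentHyperplane Ω y) (weingartenMap F Ω y : _ →ₗ[ℝ] _)

/-- `G` is the weak gradient of `u` on the open set `Ω`. -/
def HasWeakGradient {N : ℕ} (Ω : Set (EuclideanSpace ℝ (Fin N)))
    (u : EuclideanSpace ℝ (Fin N) → ℝ)
    (G : EuclideanSpace ℝ (Fin N) → EuclideanSpace ℝ (Fin N)) : Prop :=
  ∀ φ : EuclideanSpace ℝ (Fin N) → ℝ, ContDiff ℝ ∞ φ → HasCompactSupport φ → tsupport φ ⊆ Ω →
    ∀ v : EuclideanSpace ℝ (Fin N),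
      ∫ x in Ω, u x * fderiv ℝ φ x v = - ∫ x in Ω, ⟪G x, v⟫ * φ x

/-- `u ∈ W^{1,p}(Ω)`, with weak gradient `G`. -/
structure IsSobolev {N : ℕ} (p : ℝ) (Ω : Set (EuclideanSpace ℝ (Fin N)))
    (u : EuclideanSpace ℝ (Fin N) → ℝ)
    (G : EuclideanSpace ℝ (Fin N) → EuclideanSpace ℝ (Fin N)) : Prop where
  memLp : MemLp u (ENNReal.ofReal p) (volume.restrict Ω)
  memLp_gradient : MemLp G (ENNReal.ofReal p) (volume.restrict Ω)
  weakGradient : HasWeakGradient Ω u G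

/-- The surface measure `ℋ^{N-1}` on `∂Ω`; `μHE[d]` is the Hausdorff measure in its usual
normalization, for which it is Lebesgue measure on `ℝ^d`. -/
def surfaceMeasure {N : ℕ} (Ω : Set (EuclideanSpace ℝ (Fin N))) :
    Measure (EuclideanSpace ℝ (Fin N)) :=
  (μHE[N - 1]).restrict (frontier Ω)

/-- `g ∈ L^p(∂Ω)` is the trace of `u ∈ W^{1,p}(Ω)` (with weak gradient `G`): there are functions
`φ k`, smooth up to the boundary, that converge to `u` in `W^{1,p}(Ω)` and whose restrictions to
`∂Ω` converge to `g` in `L^p(∂Ω)`. This is the graph of the trace operator, the continuous extension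
of the restriction map. -/
def IsTrace {N : ℕ} (p : ℝ) (Ω : Set (EuclideanSpace ℝ (Fin N)))
    (u : EuclideanSpace ℝ (Fin N) → ℝ)
    (G : EuclideanSpace ℝ (Fin N) → EuclideanSpace ℝ (Fin N))
    (g : EuclideanSpace ℝ (Fin N) → ℝ) : Prop :=
  MemLp g (ENNReal.ofReal p) (surfaceMeasure Ω) ∧
    ∃ φ : ℕ → EuclideanSpace ℝ (Fin N) → ℝ, (∀ k, ContDiff ℝ ∞ (φ k)) ∧
      Tendsto (fun k => eLpNorm (φ k - u) (ENNReal.ofReal p) (volume.restrict Ω)) atTop (𝓝 0) ∧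
      Tendsto (fun k => eLpNorm (gradient (φ k) - G) (ENNReal.ofReal p) (volume.restrict Ω))
        atTop (𝓝 0) ∧
      Tendsto (fun k => eLpNorm (φ k - g) (ENNReal.ofReal p) (surfaceMeasure Ω)) atTop (𝓝 0)

/-- The Rayleigh quotient of the Robin problem at a function `u` with weak gradient `G` and boundary
trace `g`. -/
def rayleighQuotient {N : ℕ} (p β : ℝ) (F : EuclideanSpace ℝ (Fin N) → ℝ)
    (Ω : Set (EuclideanSpace ℝ (Fin N))) (u : EuclideanSpace ℝ (Fin N) → ℝ)
    (G : EuclideanSpace ℝ (Fin N) → EuclideanSpace ℝ (Fin N))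
    (g : EuclideanSpace ℝ (Fin N) → ℝ) : ℝ :=
  ((∫ x in Ω, F (G x) ^ p) + β * ∫ y, |g y| ^ p * F (outerNormal Ω y) ∂(surfaceMeasure Ω)) /
    ∫ x in Ω, |u x| ^ p

/-- The first Robin eigenvalue `λ₁(β, Ω)`: the infimum of the Rayleigh quotient over the nonzero
functions of `W^{1,p}(Ω)`, taken in the extended reals. -/
def firstRobinEigenvalue {N : ℕ} (p β : ℝ) (F : EuclideanSpace ℝ (Fin N) → ℝ)
    (Ω : Set (EuclideanSpace ℝ (Fin N))) : EReal :=
  sInf {q : EReal | ∃ u G g, IsSobolev p Ω u G ∧ IsTrace p Ω u G g ∧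
    ¬ (u =ᵐ[volume.restrict Ω] 0) ∧ q = (rayleighQuotient p β F Ω u G g : ℝ)}

end RobinFinsler

end

/-!
With `t = |β| ^ (1 / (p - 1))`, the test function is `u = exp (-t d)`, where `d` (`anisoDist`) is the
distance to the complement of `Ω` in the dual norm `F°` (`polarNorm`). As `d` is `1`-Lipschitz for
`F°`, one has `F(∇u) ≤ t u`, and `d = 0` on `∂Ω`. So the Rayleigh quotient of `u` is at most
`t ^ p - t ^ (p - 1) P / ∫ u ^ p`, where `P` is the anisotropic perimeter, and the theorem follows
from `∫_Ω exp (-p t d) ≤ P / (p t)`. In place of `d`, a mollification `f` within `ε` of `d` is used: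
it is still `1`-Lipschitz for `F°`, so that `exp (-t f)` is a smooth competitor with the same
gradient bound, and the other estimates change by factors that tend to `1` as `ε → 0`
(`IsBoundedC2Domain.firstRobinEigenvalue_le_of_pos`).

By the layer-cake formula, the integral inequality follows from the tube bound
`|{x ∈ Ω : d x < s}| ≤ s P` for all `s`, a consequence of nonnegative mean curvature
(`IsBoundedC2Domain.volume_anisoDist_lt_le`). The proof of that bound is in the style of Heintze and
Karcher and needs no regularity of `d`. A point `x ∈ Ω` with nearest boundary point `y` is
`x = y - d(x) n(y)`, where `n` is the anisotropic normal
(`IsGraphChart.eq_sub_smul_finslerNormal`), so that the tube is covered by the normal coordinates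
`(y, τ) ↦ y - τ n(y)`. Their Jacobian with respect to the anisotropic surface measure is
`det (1 - τ dn)`. Here `dn = A S`, with `A` the Hessian of `F` at the normal and `S` the
second fundamental form, and the inner Wulff shape of radius `τ = d(x)` touching `∂Ω` at `y` gives
`τ A S A ≤ A` (`IsGraphChart.inner_shapeOperator_hessian_le`). Hence the eigenvalues `μ` of
`1 - τ A S` are real and nonnegative, and `μ ≤ exp (μ - 1)` bounds their product by
`exp (-τ tr (A S)) ≤ 1` (`abs_det_one_sub_comp_le_one`).

The Hausdorff measure on `∂Ω` enters through one fact: orthogonal projection to a tangent hyperplane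
does not increase it, and near the point of tangency the projection of `∂Ω` has a Jacobian close to
that of the surface measure (`IsGraphChart.exists_nhds_lintegral_slab_le`). The small pieces of
`∂Ω` where this holds are put together by compactness.
-/

noncomputable section

namespace RobinFinsler

open MeasureTheory Set Filter Topology
open scoped ENNReal NNReal ContDiff RealInnerProductSpace

/-! ### Determinants -/

section LinearAlgebra

open Matrix in
/-- With `A = Bᴴ B`, the determinant is that of the symmetric matrix `1 - B S Bᴴ`, whose eigenvalues
`μ` are nonnegative by the hypothesis on `A - A S A`; they satisfy `μ ≤ exp (μ - 1)`, and the trace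
condition bounds the product of these exponentials by `1`. -/
theorem abs_det_one_sub_mul_le_one {n : Type*} [Fintype n] [DecidableEq n] {A S : Matrix n n ℝ}
    (hA : A.PosSemidef) (hS : S.IsHermitian) (hAS : (A - A * S * A).PosSemidef)
    (htr : 0 ≤ (A * S).trace) : |(1 - A * S).det| ≤ 1 := by
  obtain ⟨B, rfl⟩ : ∃ B : Matrix n n ℝ, A = Bᴴ * B := by
    open scoped MatrixOrder in
    obtain ⟨B, hB⟩ := CStarAlgebra.nonneg_iff_eq_star_mul_self.mp hA.nonneg
    exact ⟨B, hB⟩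
  have hM : (1 - B * S * Bᴴ).IsHermitian := by
    refine isHermitian_one.sub ?_
    exact isHermitian_mul_mul_conjTranspose B hS
  have hdet : (1 - Bᴴ * B * S).det = (1 - B * S * Bᴴ).det := by
    rw [Matrix.mul_assoc, det_one_sub_mul_comm]
  have htr' : (B * S * Bᴴ).trace = (Bᴴ * B * S).trace := by
    rw [Matrix.trace_mul_comm, Matrix.mul_assoc]
  have heig : ∀ i, 0 ≤ hM.eigenvalues i := by
    intro i
    set l := hM.eigenvalues i with hl
    set w : n → ℝ := (hM.eigenvectorBasis i).ofLp with hw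
    have h1 : (1 - B * S * Bᴴ) *ᵥ w = l • w := hM.mulVec_eigenvectorBasis i
    have hw0 : 0 < w ⬝ᵥ w := by
      have : w ⬝ᵥ w = 1 := by
        have := hM.eigenvectorBasis.orthonormal.1 i
        have h2 : inner ℝ (hM.eigenvectorBasis i) (hM.eigenvectorBasis i) = (1 : ℝ) := by
          rw [real_inner_self_eq_norm_sq, this]; norm_num
        rw [EuclideanSpace.inner_eq_star_dotProduct] at h2
        exact h2
      rw [this]; norm_num
    by_contra! hneg
    -- An eigenvector for an eigenvalue other than `1` lies in the range of `B`.
    set u : n → ℝ := (1 - l)⁻¹ • (S *ᵥ (Bᴴ *ᵥ w)) with hu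
    have hwu : w = B *ᵥ u := by
      have h2 : (1 - l) • w = B *ᵥ (S *ᵥ (Bᴴ *ᵥ w)) := by
        rw [sub_smul, one_smul, ← h1, sub_mulVec, one_mulVec]
        simp [Matrix.mul_assoc]
      rw [hu, mulVec_smul, ← h2, smul_smul, inv_mul_cancel₀ (by linarith), one_smul]
    have h3 := hAS.dotProduct_mulVec_nonneg u
    have h4 : star u ⬝ᵥ ((Bᴴ * B - Bᴴ * B * S * (Bᴴ * B)) *ᵥ u)
        = w ⬝ᵥ ((1 - B * S * Bᴴ) *ᵥ w) := by
      have : Bᴴ * B - Bᴴ * B * S * (Bᴴ * B) = Bᴴ * (1 - B * S * Bᴴ) * B := by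
        noncomm_ring
      rw [this, hwu, ← mulVec_mulVec, ← mulVec_mulVec, dotProduct_mulVec, ← star_mulVec]
      simp
    rw [h4, h1, dotProduct_smul, smul_eq_mul] at h3
    nlinarith
  rw [hdet, hM.det_eq_prod_eigenvalues]
  have hsum := hM.trace_eq_sum_eigenvalues
  rw [trace_sub, htr'] at hsum
  simp only [trace_one, RCLike.ofReal_real_eq_id, id] at hsum ⊢
  rw [abs_of_nonneg (Finset.prod_nonneg fun i _ => heig i)]
  calc ∏ i, hM.eigenvalues i ≤ ∏ i, Real.exp (hM.eigenvalues i - 1) := by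
        refine Finset.prod_le_prod (fun i _ => heig i) fun i _ => ?_
        linarith [Real.add_one_le_exp (hM.eigenvalues i - 1)]
    _ = Real.exp (∑ i, (hM.eigenvalues i - 1)) := (Real.exp_sum _ _).symm
    _ ≤ 1 := by
        rw [Real.exp_le_one_iff, Finset.sum_sub_distrib, ← hsum]
        simpa using htr

variable {E : Type*} [NormedAddCommGroup E] [InnerProductSpace ℝ E] [FiniteDimensional ℝ E]

theorem abs_det_one_sub_comp_le_one {A S : E →ₗ[ℝ] E} (hA : A.IsPositive) (hS : S.IsSymmetric)
    (hAS : ∀ v, ⟪S (A v), A v⟫ ≤ ⟪A v, v⟫) (htr : 0 ≤ LinearMap.trace ℝ E (A ∘ₗ S)) :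
    |LinearMap.det (1 - A ∘ₗ S)| ≤ 1 := by
  let b := stdOrthonormalBasis ℝ E
  have h1 : LinearMap.toMatrix b.toBasis b.toBasis (1 - A ∘ₗ S) =
      1 - LinearMap.toMatrix b.toBasis b.toBasis A * LinearMap.toMatrix b.toBasis b.toBasis S := by
    rw [map_sub, LinearMap.toMatrix_one, LinearMap.toMatrix_comp _ b.toBasis]
  rw [← LinearMap.det_toMatrix b.toBasis, h1]
  apply abs_det_one_sub_mul_le_one
  · rwa [LinearMap.posSemidef_toMatrix_iff]
  · exact (LinearMap.isHermitian_toMatrix_iff b).mpr hS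
  · rw [← LinearMap.toMatrix_comp _ b.toBasis, ← LinearMap.toMatrix_comp _ b.toBasis, ← map_sub,
      LinearMap.posSemidef_toMatrix_iff]
    refine ⟨fun u v => ?_, fun v => ?_⟩
    · have e1 := hA.1
      simp only [LinearMap.sub_apply, LinearMap.comp_apply, inner_sub_left, inner_sub_right]
      rw [e1 u v, e1 _ v, hS, e1]
    · have e1 := hA.1
      simp only [LinearMap.sub_apply, LinearMap.comp_apply, inner_sub_left]
      simpa [e1 (S (A v)) v] using hAS v
  · rwa [← LinearMap.toMatrix_comp _ b.toBasis, ← LinearMap.trace_eq_matrix_trace]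

/-- As `m` vanishes on the range of `B`, the map factors as a transvection after `1 - B`. -/
theorem det_id_sub_smulRight_sub {m : E →L[ℝ] ℝ} {w : E} {B : E →L[ℝ] E}
    (hm : ∀ v, m (B v) = 0) :
    (ContinuousLinearMap.id ℝ E - m.smulRight w - B).det =
      (1 - m w) * LinearMap.det (1 - (B : E →ₗ[ℝ] E)) := by
  have h : ((ContinuousLinearMap.id ℝ E - m.smulRight w - B : E →L[ℝ] E) : E →ₗ[ℝ] E) =
      LinearMap.transvection (m : E →ₗ[ℝ] ℝ) (-w) ∘ₗ (1 - (B : E →ₗ[ℝ] E)) := by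
    ext v
    simp [LinearMap.transvection.apply, hm, sub_eq_add_neg]
    abel
  rw [ContinuousLinearMap.det, h, LinearMap.det_comp, LinearMap.transvection.det]
  simp [sub_eq_add_neg]

end LinearAlgebra

/-! ### The Finsler norm -/

namespace IsFinslerNorm

variable {N : ℕ} {p : ℝ} {F : EuclideanSpace ℝ (Fin N) → ℝ}

theorem map_zero (hF : IsFinslerNorm p F) : F 0 = 0 := by
  simpa using hF.homogeneous 0 0

theorem map_neg (hF : IsFinslerNorm p F) (ξ : EuclideanSpace ℝ (Fin N)) : F (-ξ) = F ξ := by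
  simpa using hF.homogeneous (-1) ξ

theorem pos (hF : IsFinslerNorm p F) {ξ : EuclideanSpace ℝ (Fin N)} (h : ξ ≠ 0) : 0 < F ξ := by
  obtain ⟨a, ha, hle⟩ := hF.coercive
  exact (mul_pos ha (norm_pos_iff.mpr h)).trans_le (hle ξ)

theorem nonneg (hF : IsFinslerNorm p F) (ξ : EuclideanSpace ℝ (Fin N)) : 0 ≤ F ξ := by
  by_cases h : ξ = 0
  · rw [h, hF.map_zero]
  · exact (hF.pos h).le

theorem add_le (hF : IsFinslerNorm p F) (ξ η : EuclideanSpace ℝ (Fin N)) :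
    F (ξ + η) ≤ F ξ + F η := by
  have h := hF.convex.2 (mem_univ ξ) (mem_univ η) (by norm_num : (0 : ℝ) ≤ 1 / 2)
    (by norm_num : (0 : ℝ) ≤ 1 / 2) (by norm_num)
  rw [← smul_add, hF.homogeneous, smul_eq_mul, smul_eq_mul, abs_of_pos (by norm_num)] at h
  linarith

theorem continuous (hF : IsFinslerNorm p F) : Continuous F :=
  hF.convex.locallyLipschitz.continuous

theorem contDiffAt (hF : IsFinslerNorm p F) {ξ : EuclideanSpace ℝ (Fin N)} (h : ξ ≠ 0) :
    ContDiffAt ℝ 3 F ξ :=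
  hF.contDiffOn.contDiffAt (isOpen_compl_singleton.mem_nhds h)

theorem hasGradientAt (hF : IsFinslerNorm p F) {ξ : EuclideanSpace ℝ (Fin N)} (h : ξ ≠ 0) :
    HasGradientAt F (gradient F ξ) ξ :=
  ((hF.contDiffAt h).differentiableAt (by norm_num)).hasGradientAt

theorem contDiffAt_gradient (hF : IsFinslerNorm p F) {ξ : EuclideanSpace ℝ (Fin N)} (h : ξ ≠ 0) :
    ContDiffAt ℝ 2 (gradient F) ξ := by
  have h1 : ContDiffAt ℝ 2 (fderiv ℝ F) ξ := (hF.contDiffAt h).fderiv_right (by norm_num)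
  exact (InnerProductSpace.toDual ℝ _).symm.contDiff.contDiffAt.comp ξ h1

theorem hasFDerivAt_gradient (hF : IsFinslerNorm p F) {ξ : EuclideanSpace ℝ (Fin N)}
    (h : ξ ≠ 0) : HasFDerivAt (gradient F) (fderiv ℝ (gradient F) ξ) ξ :=
  ((hF.contDiffAt_gradient h).differentiableAt (by norm_num)).hasFDerivAt

theorem hasDerivAt_line (hF : IsFinslerNorm p F) {ξ : EuclideanSpace ℝ (Fin N)} (h : ξ ≠ 0)
    (v : EuclideanSpace ℝ (Fin N)) :
    HasDerivAt (fun t : ℝ => F (ξ + t • v)) ⟪gradient F ξ, v⟫ 0 := by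
  have h1 : HasDerivAt (fun t : ℝ => ξ + t • v) v 0 := by
    simpa using ((hasDerivAt_id (0 : ℝ)).smul_const v).const_add ξ
  have h2 : HasFDerivAt F (InnerProductSpace.toDual ℝ _ (gradient F ξ)) (ξ + (0 : ℝ) • v) := by
    simpa using (hF.hasGradientAt h).hasFDerivAt
  simpa [Function.comp_def] using h2.comp_hasDerivAt (0 : ℝ) h1

/-- Euler's identity for the `1`-homogeneous function `F`. -/
theorem inner_gradient_self (hF : IsFinslerNorm p F) {ξ : EuclideanSpace ℝ (Fin N)} (h : ξ ≠ 0) :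
    ⟪gradient F ξ, ξ⟫ = F ξ := by
  have h1 := hF.hasDerivAt_line h ξ
  have h2 : HasDerivAt (fun t : ℝ => (1 + t) * F ξ) (F ξ) 0 := by
    simpa using ((hasDerivAt_id (0 : ℝ)).const_add 1).mul_const (F ξ)
  refine h1.unique (h2.congr_of_eventuallyEq ?_)
  filter_upwards [lt_mem_nhds (show (-1 : ℝ) < 0 by norm_num)] with t ht
  have : ξ + t • ξ = (1 + t) • ξ := by rw [add_smul, one_smul]
  rw [this, hF.homogeneous, abs_of_pos (by linarith)]

theorem inner_gradient_le (hF : IsFinslerNorm p F) {ξ : EuclideanSpace ℝ (Fin N)} (h : ξ ≠ 0)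
    (ζ : EuclideanSpace ℝ (Fin N)) : ⟪gradient F ξ, ζ⟫ ≤ F ζ := by
  refine le_of_tendsto (hF.hasDerivAt_line h ζ).tendsto_slope_zero_right ?_
  filter_upwards [self_mem_nhdsWithin] with t ht
  have ht : 0 < t := ht
  have h1 := hF.add_le ξ (t • ζ)
  rw [hF.homogeneous, abs_of_pos ht] at h1
  simp only [zero_add, zero_smul, add_zero, smul_eq_mul]
  rw [inv_mul_le_iff₀ ht]
  linarith

theorem gradient_smul (hF : IsFinslerNorm p F) {ξ : EuclideanSpace ℝ (Fin N)} (h : ξ ≠ 0)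
    {c : ℝ} (hc : 0 < c) : gradient F (c • ξ) = gradient F ξ := by
  have hcξ : c • ξ ≠ 0 := smul_ne_zero hc.ne' h
  -- The convex function `F` has the linear minorant `⟪gradient F (c • ξ), ·⟫`, touching it at `ξ`.
  have key : IsLocalMin (fun η => F η - ⟪gradient F (c • ξ), η⟫) ξ := by
    refine Eventually.of_forall fun η => ?_
    have h1 := hF.inner_gradient_le hcξ η
    have h2 := hF.inner_gradient_self hcξ
    rw [inner_smul_right, hF.homogeneous, abs_of_pos hc] at h2
    have h3 := mul_left_cancel₀ hc.ne' h2
    simp only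
    linarith
  have hd : HasFDerivAt (fun η => F η - ⟪gradient F (c • ξ), η⟫)
      (InnerProductSpace.toDual ℝ _ (gradient F ξ) -
        InnerProductSpace.toDual ℝ _ (gradient F (c • ξ))) ξ :=
    (hF.hasGradientAt h).hasFDerivAt.sub
      (InnerProductSpace.toDual ℝ _ (gradient F (c • ξ))).hasFDerivAt
  have h0 := key.hasFDerivAt_eq_zero hd
  rw [sub_eq_zero] at h0
  exact ((InnerProductSpace.toDual ℝ _).injective h0).symm

/-- If `w` lies in the unit ball of the dual norm and `ξ` is a normal to that ball at `w`, then `w` is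
the gradient of `F` at `ξ`: the function `F - ⟪w, ·⟫` has a minimum at `ξ`. -/
theorem eq_gradient (hF : IsFinslerNorm p F) {ξ w : EuclideanSpace ℝ (Fin N)} (h : ξ ≠ 0)
    (hw : ∀ η, ⟪w, η⟫ ≤ F η) (hξ : ⟪w, ξ⟫ = F ξ) : w = gradient F ξ := by
  have key : IsLocalMin (fun η => F η - ⟪w, η⟫) ξ := by
    refine Eventually.of_forall fun η => ?_
    have h1 := hw η
    simp only
    linarith
  have hd : HasFDerivAt (fun η => F η - ⟪w, η⟫)
      (InnerProductSpace.toDual ℝ _ (gradient F ξ) - InnerProductSpace.toDual ℝ _ w) ξ :=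
    (hF.hasGradientAt h).hasFDerivAt.sub (InnerProductSpace.toDual ℝ _ w).hasFDerivAt
  have h0 := key.hasFDerivAt_eq_zero hd
  rw [sub_eq_zero] at h0
  exact ((InnerProductSpace.toDual ℝ _).injective h0).symm

theorem inner_hessian_comm (hF : IsFinslerNorm p F) {ξ : EuclideanSpace ℝ (Fin N)} (h : ξ ≠ 0)
    (v w : EuclideanSpace ℝ (Fin N)) :
    ⟪fderiv ℝ (gradient F) ξ v, w⟫ = ⟪v, fderiv ℝ (gradient F) ξ w⟫ := by
  have h1 : ∀ v w, ⟪fderiv ℝ (gradient F) ξ v, w⟫ = fderiv ℝ (fderiv ℝ F) ξ v w := by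
    intro v w
    have h2 : DifferentiableAt ℝ (fderiv ℝ F) ξ :=
      ((hF.contDiffAt h).fderiv_right (m := 2) (by norm_num)).differentiableAt (by norm_num)
    have h3 := h2.hasFDerivAt.clm_apply (hasFDerivAt_const w ξ)
    have h4 := (innerSL ℝ w).hasFDerivAt.comp ξ (hF.hasFDerivAt_gradient h)
    have h5 : (innerSL ℝ w) ∘ gradient F = fun η => fderiv ℝ F η w := by
      ext η
      simp [inner_gradient_right]
    rw [h5] at h4
    have h6 := congrArg (fun L => L v) (h4.unique h3)
    simpa [real_inner_comm] using h6
  have h4 : IsSymmSndFDerivAt ℝ F ξ := (hF.contDiffAt h).isSymmSndFDerivAt (by simp; norm_num)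
  rw [real_inner_comm _ v, h1, h1, h4.eq]

theorem hessian_self (hF : IsFinslerNorm p F) {ξ : EuclideanSpace ℝ (Fin N)} (h : ξ ≠ 0) :
    fderiv ℝ (gradient F) ξ ξ = 0 := by
  have h1 : HasDerivAt (fun t : ℝ => ξ + t • ξ) ξ 0 := by
    simpa using ((hasDerivAt_id (0 : ℝ)).smul_const ξ).const_add ξ
  have h2 : HasFDerivAt (gradient F) (fderiv ℝ (gradient F) ξ) (ξ + (0 : ℝ) • ξ) := by
    simpa using hF.hasFDerivAt_gradient h
  have h3 := h2.comp_hasDerivAt (0 : ℝ) h1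
  refine h3.unique ((hasDerivAt_const (0 : ℝ) (gradient F ξ)).congr_of_eventuallyEq ?_)
  filter_upwards [lt_mem_nhds (show (-1 : ℝ) < 0 by norm_num)] with t ht
  have : ξ + t • ξ = (1 + t) • ξ := by rw [add_smul, one_smul]
  simp only [Function.comp_apply, this]
  exact hF.gradient_smul h (by linarith)

/-- The differential of `∇F` takes values in the tangent space of the Wulff shape. -/
theorem inner_hessian_self_right (hF : IsFinslerNorm p F) {ξ : EuclideanSpace ℝ (Fin N)}
    (h : ξ ≠ 0) (v : EuclideanSpace ℝ (Fin N)) : ⟪fderiv ℝ (gradient F) ξ v, ξ⟫ = 0 := by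
  rw [hF.inner_hessian_comm h, hF.hessian_self h, inner_zero_right]

theorem inner_hessian_nonneg (hF : IsFinslerNorm p F) {ξ : EuclideanSpace ℝ (Fin N)} (h : ξ ≠ 0)
    (v : EuclideanSpace ℝ (Fin N)) : 0 ≤ ⟪fderiv ℝ (gradient F) ξ v, v⟫ := by
  have h1 : HasDerivAt (fun t : ℝ => ξ + t • v) v 0 := by
    simpa using ((hasDerivAt_id (0 : ℝ)).smul_const v).const_add ξ
  have h2 : HasFDerivAt (gradient F) (fderiv ℝ (gradient F) ξ) (ξ + (0 : ℝ) • v) := by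
    simpa using hF.hasFDerivAt_gradient h
  have h3 := (h2.comp_hasDerivAt (0 : ℝ) h1).tendsto_slope_zero_right
  have h4 := h3.inner (𝕜 := ℝ) (tendsto_const_nhds (x := v))
  have hne : ∀ᶠ t : ℝ in 𝓝[>] 0, ξ + t • v ≠ 0 := by
    have : ContinuousAt (fun t : ℝ => ξ + t • v) 0 := h1.continuousAt
    exact (this.eventually_ne (by simpa using h)).filter_mono nhdsWithin_le_nhds
  refine ge_of_tendsto h4 ?_
  filter_upwards [self_mem_nhdsWithin, hne] with t ht hη
  have ht : 0 < t := ht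
  -- Monotonicity of the gradient of a convex function.
  have e1 := hF.inner_gradient_le hη ξ
  have e2 := hF.inner_gradient_le h (ξ + t • v)
  have e3 := hF.inner_gradient_self hη
  have e4 := hF.inner_gradient_self h
  simp only [inner_add_right, inner_smul_right] at e2 e3
  simp only [Function.comp_apply, zero_add, zero_smul, add_zero, inner_smul_left, inner_sub_left]
  refine mul_nonneg (by simpa using ht.le) ?_
  have : 0 ≤ t * (⟪gradient F (ξ + t • v), v⟫ - ⟪gradient F ξ, v⟫) := by linarith
  exact nonneg_of_mul_nonneg_right this ht

/-- A Finsler norm is bounded by a multiple of the Euclidean norm. -/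
theorem exists_le_mul_norm (hF : IsFinslerNorm p F) :
    ∃ b : ℝ, 0 < b ∧ ∀ ξ, F ξ ≤ b * ‖ξ‖ := by
  obtain ⟨C, hC⟩ := (isCompact_sphere (0 : EuclideanSpace ℝ (Fin N)) 1).exists_bound_of_continuousOn
    hF.continuous.continuousOn
  refine ⟨max C 1, by positivity, fun ξ => ?_⟩
  by_cases h : ξ = 0
  · simp [h, hF.map_zero]
  · have h0 : 0 < ‖ξ‖ := norm_pos_iff.mpr h
    have h1 := hC (‖ξ‖⁻¹ • ξ) (by simp [norm_smul, h0.ne'])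
    rw [hF.homogeneous, abs_of_pos (by positivity), Real.norm_eq_abs] at h1
    have h2 := (le_abs_self _).trans h1
    rw [inv_mul_le_iff₀ h0] at h2
    nlinarith [le_max_left C 1]

end IsFinslerNorm

/-! ### The dual norm and the anisotropic distance to the complement -/

section Distance

variable {N : ℕ} {p : ℝ} {F : EuclideanSpace ℝ (Fin N) → ℝ} {Ω : Set (EuclideanSpace ℝ (Fin N))}

/-- The dual norm `F°(v) = sup ⟪ζ, v⟫ / F ζ` of `F`; the quotient has the harmless value `0` at
`ζ = 0`. -/
def polarNorm (F : EuclideanSpace ℝ (Fin N) → ℝ) (v : EuclideanSpace ℝ (Fin N)) : ℝ :=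
  ⨆ ζ, ⟪ζ, v⟫ / F ζ

/-- The distance from `x` to the complement of `Ω`, measured with the dual norm of `F`. -/
def anisoDist (F : EuclideanSpace ℝ (Fin N) → ℝ) (Ω : Set (EuclideanSpace ℝ (Fin N)))
    (x : EuclideanSpace ℝ (Fin N)) : ℝ :=
  ⨅ z : (Ωᶜ : Set (EuclideanSpace ℝ (Fin N))), polarNorm F (x - z)

namespace IsFinslerNorm

theorem exists_inner_div_le (hF : IsFinslerNorm p F) :
    ∃ K : ℝ≥0, ∀ v ζ, ⟪ζ, v⟫ / F ζ ≤ K * ‖v‖ := by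
  obtain ⟨a, ha, hle⟩ := hF.coercive
  refine ⟨⟨a⁻¹, by positivity⟩, fun v ζ => ?_⟩
  change _ ≤ a⁻¹ * ‖v‖
  by_cases h : ζ = 0
  · simp only [h, inner_zero_left, zero_div]
    positivity
  · rw [div_le_iff₀ (hF.pos h)]
    calc ⟪ζ, v⟫ ≤ ‖ζ‖ * ‖v‖ := real_inner_le_norm _ _
      _ = a⁻¹ * ‖v‖ * (a * ‖ζ‖) := by field_simp
      _ ≤ a⁻¹ * ‖v‖ * F ζ := by gcongr; exact hle ζ

theorem bddAbove_polarNorm (hF : IsFinslerNorm p F) (v : EuclideanSpace ℝ (Fin N)) :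
    BddAbove (range fun ζ => ⟪ζ, v⟫ / F ζ) := by
  obtain ⟨K, hK⟩ := hF.exists_inner_div_le
  exact ⟨K * ‖v‖, by rintro _ ⟨ζ, rfl⟩; exact hK v ζ⟩

theorem inner_le_mul_polarNorm (hF : IsFinslerNorm p F) (ζ v : EuclideanSpace ℝ (Fin N)) :
    ⟪ζ, v⟫ ≤ F ζ * polarNorm F v := by
  by_cases h : ζ = 0
  · simp [h, hF.map_zero]
  · rw [← div_le_iff₀' (hF.pos h)]
    exact le_ciSup (hF.bddAbove_polarNorm v) ζ

theorem polarNorm_le (hF : IsFinslerNorm p F) {v : EuclideanSpace ℝ (Fin N)} {c : ℝ} (hc : 0 ≤ c)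
    (h : ∀ ζ, ⟪ζ, v⟫ ≤ F ζ * c) : polarNorm F v ≤ c := by
  refine ciSup_le fun ζ => ?_
  by_cases h0 : ζ = 0
  · simpa [h0]
  · rw [div_le_iff₀' (hF.pos h0)]
    exact h ζ

theorem polarNorm_nonneg (hF : IsFinslerNorm p F) (v : EuclideanSpace ℝ (Fin N)) :
    0 ≤ polarNorm F v := by
  have h := le_ciSup (hF.bddAbove_polarNorm v) 0
  simp only [inner_zero_left, zero_div] at h
  exact h

theorem exists_polarNorm_le_mul_norm (hF : IsFinslerNorm p F) :
    ∃ K : ℝ≥0, ∀ v, polarNorm F v ≤ K * ‖v‖ := by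
  obtain ⟨K, hK⟩ := hF.exists_inner_div_le
  exact ⟨K, fun v => ciSup_le (hK v)⟩

theorem exists_norm_le_mul_polarNorm (hF : IsFinslerNorm p F) :
    ∃ b : ℝ, 0 < b ∧ ∀ v, ‖v‖ ≤ b * polarNorm F v := by
  obtain ⟨b, hb, hle⟩ := hF.exists_le_mul_norm
  refine ⟨b, hb, fun v => ?_⟩
  by_cases h : v = 0
  · simpa [h] using mul_nonneg hb.le (hF.polarNorm_nonneg 0)
  have h0 : 0 < ‖v‖ := norm_pos_iff.mpr h
  have h1 := hF.inner_le_mul_polarNorm v v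
  rw [real_inner_self_eq_norm_mul_norm] at h1
  have h2 := mul_le_mul_of_nonneg_right (hle v) (hF.polarNorm_nonneg v)
  refine le_of_mul_le_mul_left ?_ h0
  linarith

theorem polarNorm_add_le (hF : IsFinslerNorm p F) (u v : EuclideanSpace ℝ (Fin N)) :
    polarNorm F (u + v) ≤ polarNorm F u + polarNorm F v := by
  refine hF.polarNorm_le (add_nonneg (hF.polarNorm_nonneg u) (hF.polarNorm_nonneg v)) fun ζ => ?_
  rw [inner_add_right, mul_add]
  exact add_le_add (hF.inner_le_mul_polarNorm ζ u) (hF.inner_le_mul_polarNorm ζ v)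

theorem polarNorm_smul_le (hF : IsFinslerNorm p F) {c : ℝ} (hc : 0 ≤ c)
    (v : EuclideanSpace ℝ (Fin N)) : polarNorm F (c • v) ≤ c * polarNorm F v := by
  refine hF.polarNorm_le (mul_nonneg hc (hF.polarNorm_nonneg v)) fun ζ => ?_
  rw [inner_smul_right]
  nlinarith [hF.inner_le_mul_polarNorm ζ v]

theorem polarNorm_neg (hF : IsFinslerNorm p F) (v : EuclideanSpace ℝ (Fin N)) :
    polarNorm F (-v) = polarNorm F v := by
  have key : ∀ v, polarNorm F (-v) ≤ polarNorm F v := fun v => by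
    refine hF.polarNorm_le (hF.polarNorm_nonneg v) fun ζ => ?_
    have := hF.inner_le_mul_polarNorm (-ζ) v
    rwa [hF.map_neg, inner_neg_left, ← inner_neg_right] at this
  refine le_antisymm (key v) ?_
  simpa using key (-v)

theorem polarNorm_zero (hF : IsFinslerNorm p F) : polarNorm F 0 = 0 :=
  le_antisymm (hF.polarNorm_le le_rfl fun ζ => by simp) (hF.polarNorm_nonneg 0)

/-- The gradient map of `F` takes values in the Wulff shape, the unit ball of the dual norm. -/
theorem polarNorm_gradient_le_one (hF : IsFinslerNorm p F) {ξ : EuclideanSpace ℝ (Fin N)}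
    (h : ξ ≠ 0) : polarNorm F (gradient F ξ) ≤ 1 := by
  refine hF.polarNorm_le zero_le_one fun ζ => ?_
  rw [real_inner_comm, mul_one]
  exact hF.inner_gradient_le h ζ

theorem continuous_polarNorm (hF : IsFinslerNorm p F) : Continuous (polarNorm F) := by
  obtain ⟨K, hK⟩ := hF.exists_polarNorm_le_mul_norm
  refine (LipschitzWith.of_le_add_mul K fun u v => ?_).continuous
  have h1 := hF.polarNorm_add_le (u - v) v
  rw [sub_add_cancel] at h1
  have h2 := hK (u - v)
  rw [dist_eq_norm]
  linarith

theorem anisoDist_le (hF : IsFinslerNorm p F) (x : EuclideanSpace ℝ (Fin N))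
    {z : EuclideanSpace ℝ (Fin N)} (hz : z ∉ Ω) : anisoDist F Ω x ≤ polarNorm F (x - z) :=
  ciInf_le (f := fun z : (Ωᶜ : Set (EuclideanSpace ℝ (Fin N))) => polarNorm F (x - z))
    ⟨0, by rintro _ ⟨w, rfl⟩; exact hF.polarNorm_nonneg _⟩ ⟨z, hz⟩

theorem exists_anisoDist_eq (hF : IsFinslerNorm p F) (ho : IsOpen Ω) (hne : Ωᶜ.Nonempty)
    (x : EuclideanSpace ℝ (Fin N)) : ∃ z ∉ Ω, anisoDist F Ω x = polarNorm F (x - z) := by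
  obtain ⟨z₀, hz₀⟩ := hne
  obtain ⟨b, hb, hle⟩ := hF.exists_norm_le_mul_polarNorm
  have hc : Continuous fun z => polarNorm F (x - z) :=
    hF.continuous_polarNorm.comp (continuous_const.sub continuous_id)
  obtain ⟨z, hz, hmin⟩ := hc.continuousOn.exists_isMinOn' ho.isClosed_compl hz₀ (by
    refine Filter.Eventually.filter_mono inf_le_left ?_
    filter_upwards [(isCompact_closedBall x (b * polarNorm F (x - z₀))).compl_mem_cocompact]
      with w hw
    rw [mem_compl_iff, Metric.mem_closedBall, not_le, dist_comm, dist_eq_norm] at hw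
    have := hw.trans_le (hle (x - w))
    exact (lt_of_mul_lt_mul_left this hb.le).le)
  refine ⟨z, hz, le_antisymm (hF.anisoDist_le x hz) ?_⟩
  have : Nonempty (Ωᶜ : Set (EuclideanSpace ℝ (Fin N))) := ⟨⟨z, hz⟩⟩
  exact le_ciInf fun w => hmin w.2

theorem anisoDist_nonneg (hF : IsFinslerNorm p F) (x : EuclideanSpace ℝ (Fin N)) :
    0 ≤ anisoDist F Ω x :=
  Real.iInf_nonneg fun _ => hF.polarNorm_nonneg _

theorem anisoDist_eq_zero (hF : IsFinslerNorm p F) {x : EuclideanSpace ℝ (Fin N)} (hx : x ∉ Ω) :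
    anisoDist F Ω x = 0 := by
  refine le_antisymm ?_ (hF.anisoDist_nonneg x)
  simpa [hF.polarNorm_zero] using hF.anisoDist_le x hx

theorem mem_of_polarNorm_lt (hF : IsFinslerNorm p F) {x z : EuclideanSpace ℝ (Fin N)}
    (h : polarNorm F (x - z) < anisoDist F Ω x) : z ∈ Ω := by
  by_contra hz
  exact absurd (hF.anisoDist_le x hz) (not_le.mpr h)

theorem anisoDist_le_add (hF : IsFinslerNorm p F) (hne : Ωᶜ.Nonempty)
    (x y : EuclideanSpace ℝ (Fin N)) :
    anisoDist F Ω x ≤ anisoDist F Ω y + polarNorm F (x - y) := by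
  have : Nonempty (Ωᶜ : Set (EuclideanSpace ℝ (Fin N))) := hne.to_subtype
  rw [← sub_le_iff_le_add]
  refine le_ciInf fun w => ?_
  have h1 := hF.anisoDist_le x w.2
  have h2 := hF.polarNorm_add_le (x - y) (y - w)
  rw [sub_add_sub_cancel] at h2
  linarith

theorem exists_lipschitzWith_anisoDist (hF : IsFinslerNorm p F) (hne : Ωᶜ.Nonempty) :
    ∃ K : ℝ≥0, LipschitzWith K (anisoDist F Ω) := by
  obtain ⟨K, hK⟩ := hF.exists_polarNorm_le_mul_norm
  refine ⟨K, LipschitzWith.of_le_add_mul K fun u v => ?_⟩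
  have h1 := hF.anisoDist_le_add hne u v
  have h2 := hK (u - v)
  rw [dist_eq_norm]
  linarith

end IsFinslerNorm

end Distance

/-! ### Local defining functions of the boundary -/

section Chart

variable {N : ℕ} {p : ℝ} {F : EuclideanSpace ℝ (Fin N) → ℝ} {Ω : Set (EuclideanSpace ℝ (Fin N))}
  {e : EuclideanSpace ℝ (Fin N)} {ρ : EuclideanSpace ℝ (Fin N) → ℝ}
  {U : Set (EuclideanSpace ℝ (Fin N))}

/-- In the open set `U`, the set `Ω` is `{ρ > 0}`, where the `C²` function `ρ` grows with unit
speed along the vector `e`. The function `ρ` is the height above the graph that describes `∂Ω`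
in `U`. -/
structure IsGraphChart (Ω : Set (EuclideanSpace ℝ (Fin N))) (e : EuclideanSpace ℝ (Fin N))
    (ρ : EuclideanSpace ℝ (Fin N) → ℝ) (U : Set (EuclideanSpace ℝ (Fin N))) : Prop where
  contDiff : ContDiff ℝ 2 ρ
  add_smul : ∀ x (t : ℝ), ρ (x + t • e) = ρ x + t
  isOpen : IsOpen U
  mem_iff : ∀ x ∈ U, x ∈ Ω ↔ 0 < ρ x

theorem HasC2Boundary.exists_isGraphChart (h : HasC2Boundary Ω) {y : EuclideanSpace ℝ (Fin N)}
    (hy : y ∈ frontier Ω) : ∃ e ρ U, y ∈ U ∧ IsGraphChart Ω e ρ U := by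
  obtain ⟨e, he, γ, hγ, r, hr, hΩ⟩ := h y hy
  refine ⟨e, fun x => ⟪e, x⟫ - γ (x - ⟪e, x⟫ • e), Metric.ball y r, Metric.mem_ball_self hr,
    ?_, fun x t => ?_, Metric.isOpen_ball, fun x hx => ?_⟩
  · have h1 : ContDiff ℝ 2 fun x : EuclideanSpace ℝ (Fin N) => ⟪e, x⟫ := (innerSL ℝ e).contDiff
    exact h1.sub (hγ.comp (contDiff_id.sub (h1.smul contDiff_const)))
  · have : ⟪e, x + t • e⟫ = ⟪e, x⟫ + t := by
      rw [inner_add_right, inner_smul_right, real_inner_self_eq_norm_sq, he]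
      ring
    simp only [this]
    have h2 : x + t • e - (⟪e, x⟫ + t) • e = x - ⟪e, x⟫ • e := by
      rw [_root_.add_smul]; abel
    rw [h2]
    ring
  · rw [hΩ x hx, sub_pos]

/-- The unit vector field `-∇ρ / |∇ρ|`. -/
def unitNormal (ρ : EuclideanSpace ℝ (Fin N) → ℝ) (x : EuclideanSpace ℝ (Fin N)) :
    EuclideanSpace ℝ (Fin N) :=
  -(‖gradient ρ x‖⁻¹ • gradient ρ x)

/-- The vector field `∇F(-∇ρ / |∇ρ|)`, the anisotropic normal to the level sets of `ρ`. -/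
def finslerNormal (F ρ : EuclideanSpace ℝ (Fin N) → ℝ) (x : EuclideanSpace ℝ (Fin N)) :
    EuclideanSpace ℝ (Fin N) :=
  gradient F (unitNormal ρ x)

/-- The operator `-∇²ρ / |∇ρ|` on the whole space; its quadratic form on tangent vectors is the second
fundamental form. -/
def shapeOperator (ρ : EuclideanSpace ℝ (Fin N) → ℝ) (x : EuclideanSpace ℝ (Fin N)) :
    EuclideanSpace ℝ (Fin N) →L[ℝ] EuclideanSpace ℝ (Fin N) :=
  -(‖gradient ρ x‖⁻¹ • fderiv ℝ (gradient ρ) x)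

theorem IsOuterUnitNormal.unique {y ν ν' : EuclideanSpace ℝ (Fin N)}
    (h : IsOuterUnitNormal Ω y ν) (h' : IsOuterUnitNormal Ω y ν') : ν = ν' := by
  by_contra hne
  have hlt : ⟪ν, ν'⟫ < 1 := by
    have h0 : 0 < ‖ν - ν'‖ ^ 2 := by
      have := norm_pos_iff.mpr (sub_ne_zero.mpr hne)
      positivity
    rw [norm_sub_sq_real, h.1, h'.1] at h0
    linarith
  have h1 : ⟪ν, ν' - ν⟫ < 0 := by
    rw [inner_sub_right, real_inner_self_eq_norm_sq, h.1]
    linarith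
  have h2 : 0 < ⟪ν', ν' - ν⟫ := by
    rw [inner_sub_right, real_inner_self_eq_norm_sq, h'.1, real_inner_comm]
    linarith
  obtain ⟨t, ht, ht'⟩ := ((h.2.1 _ h1).and (h'.2.2 _ h2)).exists
  exact ht' (subset_closure ht)

theorem IsOuterUnitNormal.outerNormal_eq {y ν : EuclideanSpace ℝ (Fin N)}
    (h : IsOuterUnitNormal Ω y ν) : outerNormal Ω y = ν := by
  have hex : ∃ ν, IsOuterUnitNormal Ω y ν := ⟨ν, h⟩
  rw [outerNormal, dif_pos hex]
  exact hex.choose_spec.unique h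

namespace IsGraphChart

theorem eq_zero_of_mem_frontier (c : IsGraphChart Ω e ρ U) (ho : IsOpen Ω)
    {y : EuclideanSpace ℝ (Fin N)} (hy : y ∈ frontier Ω) (hU : y ∈ U) : ρ y = 0 := by
  refine le_antisymm ?_ ?_
  · rw [ho.frontier_eq] at hy
    exact not_lt.mp fun h => hy.2 ((c.mem_iff y hU).mpr h)
  · by_contra! h
    have h1 : ∀ᶠ x in 𝓝 y, ρ x < 0 := c.contDiff.continuous.continuousAt.eventually_lt_const h
    have h2 : ∃ᶠ x in 𝓝 y, x ∈ Ω := mem_closure_iff_frequently.mp hy.1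
    obtain ⟨x, hx, hx1, hx2⟩ := (h2.and_eventually (h1.and (c.isOpen.mem_nhds hU))).exists
    linarith [(c.mem_iff x hx2).mp hx]

theorem mem_frontier (c : IsGraphChart Ω e ρ U) (ho : IsOpen Ω)
    {y : EuclideanSpace ℝ (Fin N)} (hU : y ∈ U) (h : ρ y = 0) : y ∈ frontier Ω := by
  rw [ho.frontier_eq]
  refine ⟨?_, fun hy => (h ▸ (c.mem_iff y hU).mp hy).false⟩
  have hc : ContinuousAt (fun t : ℝ => y + t • e) 0 := by fun_prop
  have h0 : Tendsto (fun t : ℝ => y + t • e) (𝓝[>] 0) (𝓝 y) := by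
    have := hc.tendsto
    simp only [zero_smul, add_zero] at this
    exact this.mono_left nhdsWithin_le_nhds
  refine mem_closure_of_tendsto h0 ?_
  filter_upwards [self_mem_nhdsWithin, h0 (c.isOpen.mem_nhds hU)] with t ht htU
  rw [c.mem_iff _ htU, c.add_smul, h, zero_add]
  exact ht

theorem hasGradientAt (c : IsGraphChart Ω e ρ U) (x : EuclideanSpace ℝ (Fin N)) :
    HasGradientAt ρ (gradient ρ x) x :=
  (c.contDiff.differentiable (by norm_num) x).hasGradientAt

theorem hasDerivAt_line (c : IsGraphChart Ω e ρ U) (x v : EuclideanSpace ℝ (Fin N)) :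
    HasDerivAt (fun t : ℝ => ρ (x + t • v)) ⟪gradient ρ x, v⟫ 0 := by
  have h1 : HasDerivAt (fun t : ℝ => x + t • v) v 0 := by
    simpa using ((hasDerivAt_id (0 : ℝ)).smul_const v).const_add x
  have h2 : HasFDerivAt ρ (InnerProductSpace.toDual ℝ _ (gradient ρ x)) (x + (0 : ℝ) • v) := by
    simpa using (c.hasGradientAt x).hasFDerivAt
  simpa [Function.comp_def] using h2.comp_hasDerivAt (0 : ℝ) h1

theorem inner_gradient_axis (c : IsGraphChart Ω e ρ U) (x : EuclideanSpace ℝ (Fin N)) :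
    ⟪gradient ρ x, e⟫ = 1 := by
  refine (c.hasDerivAt_line x e).unique ?_
  simp_rw [c.add_smul]
  exact (hasDerivAt_id (0 : ℝ)).const_add (ρ x)

theorem gradient_ne_zero (c : IsGraphChart Ω e ρ U) (x : EuclideanSpace ℝ (Fin N)) :
    gradient ρ x ≠ 0 := by
  intro h
  have := c.inner_gradient_axis x
  simp [h] at this

theorem norm_gradient_pos (c : IsGraphChart Ω e ρ U) (x : EuclideanSpace ℝ (Fin N)) :
    0 < ‖gradient ρ x‖ :=
  norm_pos_iff.mpr (c.gradient_ne_zero x)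

theorem gradient_add_smul (c : IsGraphChart Ω e ρ U) (x : EuclideanSpace ℝ (Fin N)) (t : ℝ) :
    gradient ρ (x + t • e) = gradient ρ x := by
  have h : (fun y => ρ (y + t • e)) = fun y => ρ y + t := funext fun y => c.add_smul y t
  have h1 := fderiv_comp_add_right (𝕜 := ℝ) (f := ρ) (x := x) (t • e)
  rw [h, fderiv_add_const] at h1
  simp only [gradient, h1]

theorem contDiff_gradient (c : IsGraphChart Ω e ρ U) : ContDiff ℝ 1 (gradient ρ) :=
  (InnerProductSpace.toDual ℝ _).symm.contDiff.comp (c.contDiff.fderiv_right (m := 1) (by norm_num))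

theorem norm_unitNormal (c : IsGraphChart Ω e ρ U) (x : EuclideanSpace ℝ (Fin N)) :
    ‖unitNormal ρ x‖ = 1 := by
  rw [unitNormal, norm_neg, norm_smul, norm_inv, norm_norm,
    inv_mul_cancel₀ (c.norm_gradient_pos x).ne']

theorem unitNormal_ne_zero (c : IsGraphChart Ω e ρ U) (x : EuclideanSpace ℝ (Fin N)) :
    unitNormal ρ x ≠ 0 := by
  rw [← norm_ne_zero_iff, c.norm_unitNormal]
  exact one_ne_zero

theorem gradient_eq_smul_unitNormal (c : IsGraphChart Ω e ρ U) (x : EuclideanSpace ℝ (Fin N)) :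
    gradient ρ x = -(‖gradient ρ x‖ • unitNormal ρ x) := by
  rw [unitNormal, smul_neg, neg_neg, smul_smul, mul_inv_cancel₀ (c.norm_gradient_pos x).ne',
    one_smul]

theorem finslerNormal_add_smul (c : IsGraphChart Ω e ρ U) (x : EuclideanSpace ℝ (Fin N)) (t : ℝ) :
    finslerNormal F ρ (x + t • e) = finslerNormal F ρ x := by
  simp only [finslerNormal, unitNormal, c.gradient_add_smul]

theorem isOuterUnitNormal (c : IsGraphChart Ω e ρ U) (ho : IsOpen Ω)
    {y : EuclideanSpace ℝ (Fin N)} (hy : y ∈ frontier Ω) (hU : y ∈ U) :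
    IsOuterUnitNormal Ω y (unitNormal ρ y) := by
  have h0 := c.eq_zero_of_mem_frontier ho hy hU
  have hpos := inv_pos.mpr (c.norm_gradient_pos y)
  have hev : ∀ v : EuclideanSpace ℝ (Fin N), ∀ᶠ t : ℝ in 𝓝[>] 0, y + t • v ∈ U := fun v => by
    have hc : ContinuousAt (fun t : ℝ => y + t • v) 0 := by fun_prop
    exact (hc.eventually_mem (c.isOpen.mem_nhds (by simpa using hU))).filter_mono
      nhdsWithin_le_nhds
  have hinner : ∀ v, ⟪unitNormal ρ y, v⟫ = -(‖gradient ρ y‖⁻¹ * ⟪gradient ρ y, v⟫) := fun v => by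
    rw [unitNormal, inner_neg_left, real_inner_smul_left]
  have hslope : ∀ v, Tendsto (fun t : ℝ => t⁻¹ * ρ (y + t • v)) (𝓝[>] 0)
      (𝓝 ⟪gradient ρ y, v⟫) := fun v => by
    simpa [h0] using (c.hasDerivAt_line y v).tendsto_slope_zero_right
  refine ⟨c.norm_unitNormal y, fun v hv => ?_, fun v hv => ?_⟩
  · rw [hinner, neg_lt_zero] at hv
    have hv' : 0 < ⟪gradient ρ y, v⟫ := pos_of_mul_pos_right hv hpos.le
    filter_upwards [(hslope v).eventually_const_lt hv', hev v, self_mem_nhdsWithin] with t h1 h2 h3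
    exact (c.mem_iff _ h2).mpr (pos_of_mul_pos_right h1 (inv_pos.mpr h3).le)
  · rw [hinner, lt_neg, neg_zero] at hv
    have hv' : ⟪gradient ρ y, v⟫ < 0 := by
      by_contra! hcon
      exact absurd hv (not_lt.mpr (mul_nonneg hpos.le hcon))
    filter_upwards [(hslope v).eventually_lt_const hv', hev v, self_mem_nhdsWithin] with t h1 h2 h3
    have h4 : ρ (y + t • v) < 0 := by
      by_contra! hcon
      exact absurd h1 (not_lt.mpr (mul_nonneg (inv_pos.mpr h3).le hcon))
    intro hcl
    have h5 : ∀ᶠ x in 𝓝 (y + t • v), ρ x < 0 :=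
      c.contDiff.continuous.continuousAt.eventually_lt_const h4
    obtain ⟨x, hx, hx1, hx2⟩ := ((mem_closure_iff_frequently.mp hcl).and_eventually
      (h5.and (c.isOpen.mem_nhds h2))).exists
    linarith [(c.mem_iff x hx2).mp hx]

theorem outerNormal_eq (c : IsGraphChart Ω e ρ U) (ho : IsOpen Ω)
    {y : EuclideanSpace ℝ (Fin N)} (hy : y ∈ frontier Ω) (hU : y ∈ U) :
    outerNormal Ω y = unitNormal ρ y :=
  (c.isOuterUnitNormal ho hy hU).outerNormal_eq

theorem contDiff_unitNormal (c : IsGraphChart Ω e ρ U) : ContDiff ℝ 1 (unitNormal ρ) :=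
  (((c.contDiff_gradient.norm ℝ c.gradient_ne_zero).inv
    fun x => (c.norm_gradient_pos x).ne').smul c.contDiff_gradient).neg

theorem contDiff_finslerNormal (c : IsGraphChart Ω e ρ U) (hF : IsFinslerNorm p F) :
    ContDiff ℝ 1 (finslerNormal F ρ) := by
  rw [contDiff_iff_contDiffAt]
  intro x
  exact ((hF.contDiffAt_gradient (c.unitNormal_ne_zero x)).of_le (by norm_num)).comp x
    c.contDiff_unitNormal.contDiffAt

/-- The derivative of the unit normal is the shape operator up to a multiple of the normal, which
the Hessian of the `1`-homogeneous function `F` annihilates. -/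
theorem hasFDerivAt_finslerNormal (c : IsGraphChart Ω e ρ U) (hF : IsFinslerNorm p F)
    (x : EuclideanSpace ℝ (Fin N)) :
    HasFDerivAt (finslerNormal F ρ)
      ((fderiv ℝ (gradient F) (unitNormal ρ x)).comp (shapeOperator ρ x)) x := by
  have hg : HasFDerivAt (gradient ρ) (fderiv ℝ (gradient ρ) x) x :=
    (c.contDiff_gradient.differentiable (by norm_num) x).hasFDerivAt
  have hr : DifferentiableAt ℝ (fun x => ‖gradient ρ x‖⁻¹) x :=
    ((c.contDiff_gradient.norm ℝ c.gradient_ne_zero).inv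
      fun x => (c.norm_gradient_pos x).ne').differentiable (by norm_num) x
  have hN := (hr.hasFDerivAt.smul hg).neg
  have hcomp := (hF.hasFDerivAt_gradient (c.unitNormal_ne_zero x)).comp x hN
  refine hcomp.congr_fderiv ?_
  ext1 v
  have hker : fderiv ℝ (gradient F) (unitNormal ρ x) (gradient ρ x) = 0 := by
    rw [c.gradient_eq_smul_unitNormal x, _root_.map_neg, map_smul,
      hF.hessian_self (c.unitNormal_ne_zero x), smul_zero, neg_zero]
  simp [shapeOperator, hker]

theorem isSymmetric_shapeOperator (c : IsGraphChart Ω e ρ U) (x : EuclideanSpace ℝ (Fin N)) :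
    (shapeOperator ρ x : EuclideanSpace ℝ (Fin N) →ₗ[ℝ] EuclideanSpace ℝ (Fin N)).IsSymmetric := by
  have h1 : ∀ v w, ⟪fderiv ℝ (gradient ρ) x v, w⟫ = fderiv ℝ (fderiv ℝ ρ) x v w := by
    intro v w
    have h2 : DifferentiableAt ℝ (fderiv ℝ ρ) x :=
      (c.contDiff.fderiv_right (m := 1) (by norm_num)).differentiable (by norm_num) x
    have h3 := h2.hasFDerivAt.clm_apply (hasFDerivAt_const w x)
    have h4 := (innerSL ℝ w).hasFDerivAt.comp x
      (c.contDiff_gradient.differentiable (by norm_num) x).hasFDerivAt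
    have h5 : (innerSL ℝ w) ∘ gradient ρ = fun η => fderiv ℝ ρ η w := by
      ext η
      simp [inner_gradient_right]
    rw [h5] at h4
    have h6 := congrArg (fun L => L v) (h4.unique h3)
    simpa [real_inner_comm] using h6
  have h4 : IsSymmSndFDerivAt ℝ ρ x := c.contDiff.contDiffAt.isSymmSndFDerivAt (by simp)
  intro v w
  have h5 : ⟪fderiv ℝ (gradient ρ) x v, w⟫ = ⟪v, fderiv ℝ (gradient ρ) x w⟫ := by
    rw [real_inner_comm _ v, h1, h1, h4.eq]
  simp [shapeOperator, inner_smul_left, inner_smul_right, h5]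

/-- The anisotropic mean curvature is the trace on the whole space: `∇²F ∘ S` has its range in the
tangent hyperplane, so that restricting to it does not change the trace. -/
theorem anisotropicMeanCurvature_eq (c : IsGraphChart Ω e ρ U) (hF : IsFinslerNorm p F)
    (ho : IsOpen Ω) {y : EuclideanSpace ℝ (Fin N)} (hy : y ∈ frontier Ω) (hU : y ∈ U) :
    anisotropicMeanCurvature F Ω y = LinearMap.trace ℝ _
      ((fderiv ℝ (gradient F) (unitNormal ρ y) : EuclideanSpace ℝ (Fin N) →ₗ[ℝ] _) ∘ₗ
        (shapeOperator ρ y : EuclideanSpace ℝ (Fin N) →ₗ[ℝ] _)) := by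
  set D := (fderiv ℝ (gradient F) (unitNormal ρ y)).comp (shapeOperator ρ y) with hD
  have hν := c.outerNormal_eq ho hy hU
  have hT : ∀ w, w ∈ tangentHyperplane Ω y ↔ ⟪unitNormal ρ y, w⟫ = 0 := fun w => by
    rw [tangentHyperplane, hν, Submodule.mem_orthogonal_singleton_iff_inner_right]
  have hrange : ∀ w, D w ∈ tangentHyperplane Ω y := fun w => by
    rw [hT, real_inner_comm]
    exact hF.inner_hessian_self_right (c.unitNormal_ne_zero y) _
  have hw1 : HasFDerivWithinAt (anisotropicNormal F Ω) D (frontier Ω) y := by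
    refine (c.hasFDerivAt_finslerNormal hF y).hasFDerivWithinAt.congr_of_eventuallyEq ?_ ?_
    · filter_upwards [self_mem_nhdsWithin, mem_nhdsWithin_of_mem_nhds (c.isOpen.mem_nhds hU)]
        with x hx hxU
      rw [anisotropicNormal, c.outerNormal_eq ho hx hxU, finslerNormal]
    · rw [anisotropicNormal, hν, finslerNormal]
  have hw2 := hw1.differentiableWithinAt.hasFDerivWithinAt
  have h0 := c.eq_zero_of_mem_frontier ho hy hU
  -- Every tangent vector is the velocity of a curve in the boundary.
  have heq : ∀ w ∈ tangentHyperplane Ω y,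
      fderivWithin ℝ (anisotropicNormal F Ω) (frontier Ω) y w = D w := by
    intro w hw
    have hgw : ⟪gradient ρ y, w⟫ = 0 := by
      rw [c.gradient_eq_smul_unitNormal y, inner_neg_left, inner_smul_left, (hT w).mp hw]
      simp
    set k : ℝ → EuclideanSpace ℝ (Fin N) := fun t => y + t • w + (-ρ (y + t • w)) • e with hk
    have hk0 : k 0 = y := by simp [hk, h0]
    have hkd : HasDerivAt k w 0 := by
      have h1 : HasDerivAt (fun t : ℝ => y + t • w) w 0 := by
        simpa using ((hasDerivAt_id (0 : ℝ)).smul_const w).const_add y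
      have h2 : HasDerivAt k (w + (-⟪gradient ρ y, w⟫) • e) 0 :=
        h1.add ((c.hasDerivAt_line y w).neg.smul_const e)
      rw [hgw] at h2
      simpa using h2
    have hmem : k ⁻¹' (frontier Ω) ∈ 𝓝 (0 : ℝ) := by
      have : ∀ᶠ t in 𝓝 (0 : ℝ), k t ∈ U :=
        hkd.continuousAt.eventually_mem (c.isOpen.mem_nhds (by rwa [hk0]))
      filter_upwards [this] with t ht
      refine c.mem_frontier ho ht ?_
      simp only [hk, c.add_smul, add_neg_cancel]
    have hcomp : ∀ L : EuclideanSpace ℝ (Fin N) →L[ℝ] EuclideanSpace ℝ (Fin N),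
        HasFDerivWithinAt (anisotropicNormal F Ω) L (frontier Ω) y →
          HasDerivAt (anisotropicNormal F Ω ∘ k) (L w) 0 := fun L hL =>
      ((hk0.symm ▸ hL : HasFDerivWithinAt (anisotropicNormal F Ω) L (frontier Ω)
        (k 0)).comp_hasDerivWithinAt (0 : ℝ) hkd.hasDerivWithinAt
          (mapsTo_preimage k (frontier Ω))).hasDerivAt hmem
    exact (hcomp _ hw2).unique (hcomp _ hw1)
  have hW : (weingartenMap F Ω y : tangentHyperplane Ω y →ₗ[ℝ] tangentHyperplane Ω y) =
      (D : EuclideanSpace ℝ (Fin N) →ₗ[ℝ] _).restrict fun w _ => hrange w := by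
    ext1 w
    simp only [weingartenMap, ContinuousLinearMap.coe_coe, ContinuousLinearMap.comp_apply,
      Submodule.subtypeL_apply]
    rw [heq w w.2]
    exact Submodule.orthogonalProjectionOnto_mem_subspace_eq_self (⟨D w, hrange w⟩ :
      tangentHyperplane Ω y)
  rw [anisotropicMeanCurvature, hW, LinearMap.trace_restrict_eq_of_forall_mem _ _ hrange]
  rfl

end IsGraphChart

end Chart

/-! ### Contact of an inner Wulff shape with the boundary -/

/-- The second derivative is nonnegative at a local minimum: were it negative, the point would be a
local maximum too, and the function locally constant. -/
theorem _root_.IsLocalMin.nonneg_of_hasDerivAt_hasDerivAt {f f' : ℝ → ℝ} {d a : ℝ}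
    (hmin : IsLocalMin f a) (hf : ∀ᶠ t in 𝓝 a, HasDerivAt f (f' t) t) (hf' : HasDerivAt f' d a) :
    0 ≤ d := by
  by_contra! hd
  have h1 : deriv f =ᶠ[𝓝 a] f' := hf.mono fun t ht => ht.deriv
  have h2 : deriv (deriv f) a = d := by rw [h1.deriv_eq, hf'.deriv]
  have hmax := isLocalMax_of_deriv_deriv_neg (by rwa [h2]) hmin.deriv_eq_zero
    hf.self_of_nhds.continuousAt
  have h3 : f =ᶠ[𝓝 a] fun _ => f a := by
    filter_upwards [hmin, hmax] with t h4 h5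
    exact le_antisymm h5 h4
  have h4 : deriv f =ᶠ[𝓝 a] fun _ => 0 := by
    refine h3.deriv.trans ?_
    simp
  rw [h4.deriv_eq] at h2
  simp at h2
  exact hd.ne h2.symm

section Contact

variable {N : ℕ} {p : ℝ} {F : EuclideanSpace ℝ (Fin N) → ℝ} {Ω : Set (EuclideanSpace ℝ (Fin N))}
  {e : EuclideanSpace ℝ (Fin N)} {ρ : EuclideanSpace ℝ (Fin N) → ℝ}
  {U : Set (EuclideanSpace ℝ (Fin N))} {x y z : EuclideanSpace ℝ (Fin N)}

theorem IsFinslerNorm.anisoDist_pos (hF : IsFinslerNorm p F) (hx : x ∈ Ω) (hy : y ∉ Ω)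
    (hxy : anisoDist F Ω x = polarNorm F (x - y)) : 0 < anisoDist F Ω x := by
  obtain ⟨b, hb, hle⟩ := hF.exists_norm_le_mul_polarNorm
  have h1 : 0 < ‖x - y‖ := by
    rw [norm_pos_iff, sub_ne_zero]
    rintro rfl
    exact hy hx
  rw [hxy]
  exact pos_of_mul_pos_right (h1.trans_le (hle _)) hb.le

theorem IsFinslerNorm.mem_closure_of_polarNorm_le (hF : IsFinslerNorm p F)
    (hpos : 0 < anisoDist F Ω x) (hz : polarNorm F (x - z) ≤ anisoDist F Ω x) :
    z ∈ closure Ω := by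
  have hc : ContinuousAt (fun t : ℝ => x + t • (z - x)) 1 := by fun_prop
  have h0 : Tendsto (fun t : ℝ => x + t • (z - x)) (𝓝[<] 1) (𝓝 z) := by
    have := hc.tendsto
    simp only [one_smul, add_sub_cancel] at this
    exact this.mono_left nhdsWithin_le_nhds
  refine mem_closure_of_tendsto h0 ?_
  filter_upwards [self_mem_nhdsWithin,
    mem_nhdsWithin_of_mem_nhds (lt_mem_nhds (show (0 : ℝ) < 1 by norm_num))] with t ht1 ht0
  refine hF.mem_of_polarNorm_lt (x := x) ?_
  have h1 : x - (x + t • (z - x)) = t • (x - z) := by module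
  rw [h1]
  refine (hF.polarNorm_smul_le ht0.le _).trans_lt ?_
  have ht1 : t < 1 := ht1
  nlinarith

theorem IsFinslerNorm.mem_frontier_of_anisoDist_eq (hF : IsFinslerNorm p F) (ho : IsOpen Ω)
    (hx : x ∈ Ω) (hy : y ∉ Ω) (hxy : anisoDist F Ω x = polarNorm F (x - y)) : y ∈ frontier Ω := by
  rw [ho.frontier_eq]
  exact ⟨hF.mem_closure_of_polarNorm_le (hF.anisoDist_pos hx hy hxy) hxy.ge, hy⟩

namespace IsGraphChart

theorem nonneg_of_mem_closure (c : IsGraphChart Ω e ρ U) (hz : z ∈ closure Ω) (hU : z ∈ U) :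
    0 ≤ ρ z := by
  by_contra! h
  have h1 : ∀ᶠ x in 𝓝 z, ρ x < 0 := c.contDiff.continuous.continuousAt.eventually_lt_const h
  obtain ⟨x, hx, hx1, hx2⟩ := ((mem_closure_iff_frequently.mp hz).and_eventually
    (h1.and (c.isOpen.mem_nhds hU))).exists
  linarith [(c.mem_iff x hx2).mp hx]

/-- First-order contact: the largest Wulff shape centred at `x` inside `Ω` touches `∂Ω` at `y`, so
that both have the same normal at `y`. -/
theorem eq_sub_smul_finslerNormal (c : IsGraphChart Ω e ρ U) (hF : IsFinslerNorm p F)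
    (ho : IsOpen Ω) (hx : x ∈ Ω) (hy : y ∉ Ω) (hU : y ∈ U)
    (hxy : anisoDist F Ω x = polarNorm F (x - y)) :
    x = y - anisoDist F Ω x • finslerNormal F ρ y := by
  have hpos := hF.anisoDist_pos hx hy hxy
  have hfr := hF.mem_frontier_of_anisoDist_eq ho hx hy hxy
  have hn := c.isOuterUnitNormal ho hfr hU
  have hν := c.unitNormal_ne_zero y
  set ν := unitNormal ρ y with hνdef
  set σ := anisoDist F Ω x with hσ
  have hw : polarNorm F (x - (x + σ • gradient F ν)) ≤ σ := by
    rw [sub_add_cancel_left, hF.polarNorm_neg]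
    refine (hF.polarNorm_smul_le hpos.le _).trans ?_
    nlinarith [hF.polarNorm_gradient_le_one hν]
  have h1 : ⟪ν, (x + σ • gradient F ν) - y⟫ ≤ 0 := by
    by_contra! hcon
    obtain ⟨t, ht, ht0, ht1⟩ := ((hn.2.2 _ hcon).and
      (Ioo_mem_nhdsGT (show (0 : ℝ) < 1 by norm_num))).exists
    refine ht (hF.mem_closure_of_polarNorm_le hpos ?_)
    have h2 : x - (y + t • ((x + σ • gradient F ν) - y)) =
        (1 - t) • (x - y) + t • (x - (x + σ • gradient F ν)) := by module
    rw [h2]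
    refine (hF.polarNorm_add_le _ _).trans ?_
    have h3 := hF.polarNorm_smul_le (sub_nonneg.mpr (le_of_lt ht1)) (x - y)
    have h4 := hF.polarNorm_smul_le ht0.le (x - (x + σ • gradient F ν))
    rw [← hxy] at h3
    nlinarith
  have h2 : ⟪gradient F ν, ν⟫ = F ν := hF.inner_gradient_self hν
  have h3 : polarNorm F (y - x) = σ := by rw [← neg_sub, hF.polarNorm_neg, hxy]
  have h4 : σ * F ν ≤ ⟪ν, y - x⟫ := by
    simp only [inner_add_right, inner_sub_right, inner_smul_right] at h1 ⊢
    rw [real_inner_comm] at h2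
    rw [h2] at h1
    linarith
  have h5 : σ⁻¹ • (y - x) = gradient F ν := by
    refine hF.eq_gradient hν (fun η => ?_) (le_antisymm ?_ ?_)
    · rw [real_inner_smul_left, inv_mul_le_iff₀ hpos, real_inner_comm]
      have := hF.inner_le_mul_polarNorm η (y - x)
      rw [h3] at this
      linarith
    · rw [real_inner_smul_left, inv_mul_le_iff₀ hpos, real_inner_comm]
      have := hF.inner_le_mul_polarNorm ν (y - x)
      rw [h3] at this
      linarith
    · rw [real_inner_smul_left, le_inv_mul_iff₀ hpos, real_inner_comm]
      exact h4
  rw [finslerNormal, ← hνdef, ← h5, smul_smul, mul_inv_cancel₀ hpos.ne', one_smul, sub_sub_cancel]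

/-- Second-order contact: at the contact point `y`, the boundary of `Ω` curves at most as much as
the Wulff shape touching it from inside. The curve `t ↦ x + σ ∇F(ν + t v)` runs on that Wulff
shape, so that `ρ` has a minimum along it at `t = 0`. -/
theorem inner_shapeOperator_hessian_le (c : IsGraphChart Ω e ρ U) (hF : IsFinslerNorm p F)
    (ho : IsOpen Ω) (hx : x ∈ Ω) (hy : y ∉ Ω) (hU : y ∈ U)
    (hxy : anisoDist F Ω x = polarNorm F (x - y)) (v : EuclideanSpace ℝ (Fin N)) :
    anisoDist F Ω x * ⟪shapeOperator ρ y (fderiv ℝ (gradient F) (unitNormal ρ y) v),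
      fderiv ℝ (gradient F) (unitNormal ρ y) v⟫ ≤
      ⟪fderiv ℝ (gradient F) (unitNormal ρ y) v, v⟫ := by
  have hpos := hF.anisoDist_pos hx hy hxy
  have hfr := hF.mem_frontier_of_anisoDist_eq ho hx hy hxy
  have hν := c.unitNormal_ne_zero y
  have h0 := c.eq_zero_of_mem_frontier ho hfr hU
  have hxeq := c.eq_sub_smul_finslerNormal hF ho hx hy hU hxy
  rw [finslerNormal] at hxeq
  set ν := unitNormal ρ y with hνdef
  set σ := anisoDist F Ω x with hσ
  set k := ‖gradient ρ y‖ with hk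
  have hkpos : 0 < k := c.norm_gradient_pos y
  set l : ℝ → EuclideanSpace ℝ (Fin N) := fun t => ν + t • v with hl
  have hl' : ∀ t, HasDerivAt l v t := fun t => by
    have := ((hasDerivAt_id t).smul_const v).const_add ν
    rwa [one_smul] at this
  have hl0 : l 0 = ν := by simp [hl]
  have hlne : ∀ᶠ t in 𝓝 (0 : ℝ), l t ≠ 0 :=
    (hl' 0).continuousAt.eventually_ne (by rwa [hl0])
  set z : ℝ → EuclideanSpace ℝ (Fin N) := fun t => x + σ • gradient F (l t) with hz
  set q : ℝ → EuclideanSpace ℝ (Fin N) := fun t => σ • fderiv ℝ (gradient F) (l t) v with hq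
  have hz0 : z 0 = y := by simp only [hz, hl0]; rw [hxeq]; abel
  have hz' : ∀ t, l t ≠ 0 → HasDerivAt z (q t) t := fun t ht =>
    (((hF.hasFDerivAt_gradient ht).comp_hasDerivAt t (hl' t)).const_smul σ).const_add x
  have hzc : ContinuousAt z 0 := (hz' 0 (by rwa [hl0])).continuousAt
  have hmin : IsLocalMin (ρ ∘ z) 0 := by
    filter_upwards [hlne, hzc.eventually_mem (c.isOpen.mem_nhds (by rwa [hz0]))] with t ht htU
    simp only [Function.comp_apply, hz0, h0]
    refine c.nonneg_of_mem_closure (hF.mem_closure_of_polarNorm_le (x := x) hpos ?_) htU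
    simp only [hz, sub_add_cancel_left, hF.polarNorm_neg]
    refine (hF.polarNorm_smul_le hpos.le _).trans ?_
    nlinarith [hF.polarNorm_gradient_le_one ht]
  -- Adding a multiple of `ν + t v`, which is orthogonal to `q t`, makes the first factor of the
  -- derivative vanish at `t = 0`; its derivative there does not see the third derivatives of `F`.
  set V : ℝ → EuclideanSpace ℝ (Fin N) := fun t => gradient ρ (z t) + k • l t with hV
  have hV0 : V 0 = 0 := by
    simp only [hV, hz0, hl0, hk]
    rw [c.gradient_eq_smul_unitNormal y, norm_neg, norm_smul, c.norm_unitNormal]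
    simp [hνdef]
  have hfd : ∀ᶠ t in 𝓝 (0 : ℝ), HasDerivAt (ρ ∘ z) ⟪V t, q t⟫ t := by
    filter_upwards [hlne] with t ht
    have h1 := (c.hasGradientAt (z t)).hasFDerivAt.comp_hasDerivAt t (hz' t ht)
    refine h1.congr_deriv ?_
    have h2 : ⟪l t, q t⟫ = 0 := by
      rw [hq, real_inner_comm, real_inner_smul_left, hF.inner_hessian_self_right ht, mul_zero]
    simp only [InnerProductSpace.toDual_apply_apply, hV, inner_add_left, real_inner_smul_left, h2,
      mul_zero, add_zero]
  have hVd : HasDerivAt V (fderiv ℝ (gradient ρ) y (q 0) + k • v) 0 := by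
    have h1 : HasFDerivAt (gradient ρ) (fderiv ℝ (gradient ρ) y) (z 0) := by
      rw [hz0]
      exact (c.contDiff_gradient.differentiable (by norm_num) y).hasFDerivAt
    exact (h1.comp_hasDerivAt (0 : ℝ) (hz' 0 (by rwa [hl0]))).add ((hl' 0).const_smul k)
  have hqd : DifferentiableAt ℝ q 0 := by
    have h1 : DifferentiableAt ℝ (fderiv ℝ (gradient F)) (l 0) := by
      rw [hl0]
      exact ((hF.contDiffAt_gradient hν).fderiv_right (m := 1) (by norm_num)).differentiableAt
        (by norm_num)
    exact ((h1.comp (0 : ℝ) (hl' 0).differentiableAt).clm_apply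
      (differentiableAt_const v)).const_smul σ
  have hsecond := hmin.nonneg_of_hasDerivAt_hasDerivAt hfd (hVd.inner ℝ hqd.hasDerivAt)
  rw [hV0, inner_zero_left, zero_add] at hsecond
  simp only [hq, hl0, map_smul, inner_add_left, real_inner_smul_left, inner_smul_right]
    at hsecond
  simp only [shapeOperator, ← hk, _root_.neg_apply, _root_.smul_apply,
    inner_neg_left, real_inner_smul_left]
  set A := fderiv ℝ (gradient F) ν with hA
  have e1 : k * (σ * ⟪v, A v⟫) + σ * (σ * ⟪fderiv ℝ (gradient ρ) y (A v), A v⟫) =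
    σ * k * (⟪A v, v⟫ - σ * -(k⁻¹ * ⟪fderiv ℝ (gradient ρ) y (A v), A v⟫)) := by
    rw [real_inner_comm (A v) v]
    field_simp
    ring
  have e2 : 0 ≤ ⟪A v, v⟫ - σ * -(k⁻¹ * ⟪fderiv ℝ (gradient ρ) y (A v), A v⟫) := by
    refine nonneg_of_mul_nonneg_right ?_ (mul_pos hpos hkpos)
    rw [← e1]
    linarith
  linarith

end IsGraphChart

end Contact

/-! ### Hausdorff measure and projections to hyperplanes -/

section Hausdorff

variable {E : Type*} [NormedAddCommGroup E] [InnerProductSpace ℝ E] [FiniteDimensional ℝ E]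
  [MeasurableSpace E] [BorelSpace E]

theorem euclideanHausdorffMeasure_orthogonalProjectionOnto_le (K : Submodule ℝ E) (d : ℕ)
    (A : Set E) : μHE[d] (K.orthogonalProjectionOnto '' A) ≤ μHE[d] A := by
  simp only [Measure.euclideanHausdorffMeasure_def, Measure.smul_apply]
  exact smul_le_smul_of_nonneg_left
    (hausdorffMeasure_orthogonalProjectionOnto_le K d A (by positivity)) (by positivity)

/-- A set whose points have heights over the hyperplane `νᗮ` in `J` and projections to it among those
of `A` has at most the volume of a cylinder over the projection of `A`. -/
theorem volume_le_of_forall_mem_hyperplane {ν : E} (hν : ‖ν‖ = 1) {J : Set ℝ} {A S : Set E}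
    (h : ∀ z ∈ S, ⟪ν, z⟫ ∈ J ∧ ∃ a ∈ A,
      (ℝ ∙ ν)ᗮ.orthogonalProjectionOnto z = (ℝ ∙ ν)ᗮ.orthogonalProjectionOnto a) :
    volume S ≤ volume J * μHE[Module.finrank ℝ E - 1] A := by
  have hν0 : ν ≠ 0 := by
    rw [← norm_ne_zero_iff, hν]
    exact one_ne_zero
  set K := ℝ ∙ ν with hK
  let φ : ℝ ≃ₗᵢ[ℝ] K := LinearIsometryEquiv.toSpanUnitSingleton ν hν
  have hsub : S ⊆ (K.measurableEquivProd (0 : E)) ⁻¹'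
      ((φ.symm ⁻¹' J) ×ˢ (Kᗮ.orthogonalProjectionOnto '' A)) := by
    intro z hz
    obtain ⟨h1, a, ha, h2⟩ := h z hz
    refine ⟨?_, ⟨a, ha, ?_⟩⟩
    · have h3 : K.orthogonalProjectionOnto z = φ ⟪ν, z⟫ := by
        ext
        exact Submodule.starProjection_unit_singleton ℝ hν z
      simp only [Submodule.measurableEquivProd_apply, vsub_eq_sub, sub_zero, mem_preimage, h3,
        LinearIsometryEquiv.symm_apply_apply]
      exact h1
    · rw [← h2]
      simp only [Submodule.measurableEquivProd_apply, vsub_eq_sub, sub_zero]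
      rfl
  have hmp := K.measurePreserving_measurableEquivProd (0 : E)
  rw [InnerProductSpace.euclideanHausdorffMeasure_eq_volume] at hmp
  have hfin : Module.finrank ℝ Kᗮ = Module.finrank ℝ E - 1 := by
    rw [← K.finrank_add_finrank_orthogonal, hK, finrank_span_singleton hν0, Nat.add_sub_cancel_left]
  calc volume S ≤ volume ((K.measurableEquivProd (0 : E)) ⁻¹'
        ((φ.symm ⁻¹' J) ×ˢ (Kᗮ.orthogonalProjectionOnto '' A))) := measure_mono hsub
    _ = volume (φ.symm ⁻¹' J) * volume (Kᗮ.orthogonalProjectionOnto '' A) := by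
        rw [hmp.measure_preimage_equiv, Measure.volume_eq_prod, Measure.prod_prod]
    _ ≤ volume J * μHE[Module.finrank ℝ E - 1] A := by
        refine mul_le_mul' (le_of_eq ?_) ?_
        · exact φ.symm.measurePreserving.measure_preimage_equiv
            (f := φ.symm.toHomeomorph.toMeasurableEquiv) J
        · rw [← InnerProductSpace.euclideanHausdorffMeasure_eq_volume, hfin]
          exact euclideanHausdorffMeasure_orthogonalProjectionOnto_le _ _ _

theorem euclideanHausdorffMeasure_lt_top_of_norm_le_projection {ν : E} (hν : ν ≠ 0) {A : Set E}
    (hb : Bornology.IsBounded A) {C : ℝ≥0} (h : ∀ x ∈ A, ∀ y ∈ A, ‖x - y‖ ≤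
      C * ‖(ℝ ∙ ν)ᗮ.orthogonalProjectionOnto x - (ℝ ∙ ν)ᗮ.orthogonalProjectionOnto y‖) :
    μHE[Module.finrank ℝ E - 1] A < ⊤ := by
  set K := ℝ ∙ ν with hK
  set d := Module.finrank ℝ E - 1 with hd
  have hfin : Module.finrank ℝ Kᗮ = d := by
    rw [hd, ← K.finrank_add_finrank_orthogonal, hK, finrank_span_singleton hν,
      Nat.add_sub_cancel_left]
  have hanti : AntilipschitzWith C (A.domRestrict Kᗮ.orthogonalProjectionOnto) :=
    AntilipschitzWith.of_le_mul_dist fun x y => by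
      rw [Subtype.dist_eq, dist_eq_norm, dist_eq_norm]
      exact h x x.2 y y.2
  have h1 := hanti.le_hausdorffMeasure_image (d := d) (by positivity) univ
  have h2 : μH[(d : ℝ)] (univ : Set A) = μH[(d : ℝ)] A := by
    have := (isometry_subtype_coe (s := A)).hausdorffMeasure_image (d := d)
      (Or.inl (by positivity)) univ
    rw [← this]
    simp
  have h3 : μHE[d] (Kᗮ.orthogonalProjectionOnto '' A) < ⊤ := by
    rw [← hfin, InnerProductSpace.euclideanHausdorffMeasure_eq_volume]
    exact (Kᗮ.orthogonalProjectionOnto.lipschitz.isBounded_image hb).measure_lt_top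
  have h4 : μH[(d : ℝ)] (Kᗮ.orthogonalProjectionOnto '' A) < ⊤ := by
    by_contra! hcon
    rw [top_le_iff] at hcon
    rw [Measure.euclideanHausdorffMeasure_def, Measure.smul_apply, hcon, ENNReal.smul_top] at h3
    simp [Measure.addHaarScalarFactor_volume_hausdorffMeasure_ne_zero] at h3
  rw [Measure.euclideanHausdorffMeasure_def, Measure.smul_apply, ENNReal.smul_def, smul_eq_mul]
  refine ENNReal.mul_lt_top ENNReal.coe_lt_top ?_
  rw [← h2]
  refine h1.trans_lt (ENNReal.mul_lt_top ?_ ?_)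
  · exact ENNReal.rpow_lt_top_of_nonneg (by positivity) ENNReal.coe_ne_top
  · rwa [image_univ, range_domRestrict]

end Hausdorff

/-! ### Volume of the tube over a small piece of the boundary -/

section Tube

variable {N : ℕ} {p : ℝ} {F : EuclideanSpace ℝ (Fin N) → ℝ} {Ω : Set (EuclideanSpace ℝ (Fin N))}
  {e : EuclideanSpace ℝ (Fin N)} {ρ : EuclideanSpace ℝ (Fin N) → ℝ}
  {U A : Set (EuclideanSpace ℝ (Fin N))} {x y z : EuclideanSpace ℝ (Fin N)} {s : ℝ}

/-- The points of `Ω` at anisotropic distance less than `s` from the complement that have a nearest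
point in `A`. -/
def tube (F : EuclideanSpace ℝ (Fin N) → ℝ) (Ω A : Set (EuclideanSpace ℝ (Fin N))) (s : ℝ) :
    Set (EuclideanSpace ℝ (Fin N)) :=
  {x | x ∈ Ω ∧ anisoDist F Ω x < s ∧ ∃ y ∈ A, y ∉ Ω ∧ anisoDist F Ω x = polarNorm F (x - y)}

/-- The points at height between `0` and `s` above the part `A` of the graph `{ρ = 0}`. -/
def slab (e : EuclideanSpace ℝ (Fin N)) (ρ : EuclideanSpace ℝ (Fin N) → ℝ)
    (A : Set (EuclideanSpace ℝ (Fin N))) (s : ℝ) : Set (EuclideanSpace ℝ (Fin N)) :=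
  {z | z - ρ z • e ∈ A ∧ 0 < ρ z ∧ ρ z < s}

/-- Anisotropic normal coordinates: the point at height `τ` above the boundary point `y` of the
graph `{ρ = 0}` goes to `y - τ n(y)`, where `n` is the anisotropic normal. -/
def normalMap (F : EuclideanSpace ℝ (Fin N) → ℝ) (e : EuclideanSpace ℝ (Fin N))
    (ρ : EuclideanSpace ℝ (Fin N) → ℝ) (z : EuclideanSpace ℝ (Fin N)) :
    EuclideanSpace ℝ (Fin N) :=
  z - ρ z • (e + finslerNormal F ρ z)

/-- The derivative of `normalMap`. -/
def normalMapDeriv (F : EuclideanSpace ℝ (Fin N) → ℝ) (e : EuclideanSpace ℝ (Fin N))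
    (ρ : EuclideanSpace ℝ (Fin N) → ℝ) (z : EuclideanSpace ℝ (Fin N)) :
    EuclideanSpace ℝ (Fin N) →L[ℝ] EuclideanSpace ℝ (Fin N) :=
  ContinuousLinearMap.id ℝ _ - (fderiv ℝ ρ z).smulRight (e + finslerNormal F ρ z) -
    ρ z • fderiv ℝ (finslerNormal F ρ) z

/-- The density of the anisotropic surface measure in the graph coordinates. -/
def surfaceDensity (F ρ : EuclideanSpace ℝ (Fin N) → ℝ) (z : EuclideanSpace ℝ (Fin N)) : ℝ :=
  ‖gradient ρ z‖ * F (unitNormal ρ z)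

/-- The map that flattens the graph `{ρ = 0}` to its tangent hyperplane at a point with normal `ν`
and takes the height above the graph to the height above this hyperplane. -/
def flatten (e ν : EuclideanSpace ℝ (Fin N)) (ρ : EuclideanSpace ℝ (Fin N) → ℝ)
    (z : EuclideanSpace ℝ (Fin N)) : EuclideanSpace ℝ (Fin N) :=
  (z - ρ z • e) - ⟪ν, z - ρ z • e⟫ • ν + ρ z • ν

/-- The derivative of `flatten` at a point where `ρ` has derivative `m`. -/
def flattenDeriv (e ν : EuclideanSpace ℝ (Fin N))
    (m : EuclideanSpace ℝ (Fin N) →L[ℝ] ℝ) :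
    EuclideanSpace ℝ (Fin N) →L[ℝ] EuclideanSpace ℝ (Fin N) :=
  (ContinuousLinearMap.id ℝ _ - m.smulRight e) -
    ((innerSL ℝ ν).comp (ContinuousLinearMap.id ℝ _ - m.smulRight e)).smulRight ν + m.smulRight ν

namespace IsGraphChart

theorem hasFDerivAt_normalMap (c : IsGraphChart Ω e ρ U) (hF : IsFinslerNorm p F)
    (z : EuclideanSpace ℝ (Fin N)) :
    HasFDerivAt (normalMap F e ρ) (normalMapDeriv F e ρ z) z := by
  have h1 : HasFDerivAt ρ (fderiv ℝ ρ z) z := (c.contDiff.differentiable (by norm_num) z).hasFDerivAt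
  have h2 : HasFDerivAt (finslerNormal F ρ) (fderiv ℝ (finslerNormal F ρ) z) z :=
    ((c.contDiff_finslerNormal hF).differentiable (by norm_num) z).hasFDerivAt
  refine ((hasFDerivAt_id z).sub (h1.smul (h2.const_add e))).congr_fderiv ?_
  rw [normalMapDeriv]
  abel

theorem continuous_det_normalMapDeriv (c : IsGraphChart Ω e ρ U) (hF : IsFinslerNorm p F) :
    Continuous fun z => (normalMapDeriv F e ρ z).det := by
  have h1 : Continuous (fderiv ℝ ρ) := c.contDiff.continuous_fderiv (by norm_num)
  have h2 := (c.contDiff_finslerNormal hF).continuous_fderiv (by norm_num)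
  have h3 := (c.contDiff_finslerNormal hF).continuous
  have h4 := c.contDiff.continuous
  refine ContinuousLinearMap.continuous_det.comp ?_
  unfold normalMapDeriv
  fun_prop

theorem continuous_surfaceDensity (c : IsGraphChart Ω e ρ U) (hF : IsFinslerNorm p F) :
    Continuous (surfaceDensity F ρ) :=
  c.contDiff_gradient.continuous.norm.mul (hF.continuous.comp c.contDiff_unitNormal.continuous)

theorem measurableSet_slab (c : IsGraphChart Ω e ρ U) (hA : MeasurableSet A) :
    MeasurableSet (slab e ρ A s) := by
  have h1 := c.contDiff.continuous
  have h2 : Continuous fun z => z - ρ z • e := by fun_prop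
  exact (h2.measurable hA).inter ((measurableSet_lt measurable_const h1.measurable).inter
    (measurableSet_lt h1.measurable measurable_const))

/-- The Jacobian bound at the parameters `(y, d(x))` of a point `x` with nearest boundary point `y`:
the contact conditions and the sign of the curvature give `|det (1 - d(x) dn)| ≤ 1`. -/
theorem abs_det_normalMapDeriv_le (c : IsGraphChart Ω e ρ U) (hF : IsFinslerNorm p F)
    (ho : IsOpen Ω) (hH : 0 ≤ anisotropicMeanCurvature F Ω y) (hx : x ∈ Ω) (hy : y ∉ Ω) (hU : y ∈ U)
    (hxy : anisoDist F Ω x = polarNorm F (x - y)) :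
    |(normalMapDeriv F e ρ (y + anisoDist F Ω x • e)).det| ≤
      surfaceDensity F ρ (y + anisoDist F Ω x • e) := by
  have hfr := hF.mem_frontier_of_anisoDist_eq ho hx hy hxy
  have hν := c.unitNormal_ne_zero y
  have hpos := hF.anisoDist_pos hx hy hxy
  have hsecond := c.inner_shapeOperator_hessian_le hF ho hx hy hU hxy
  rw [c.anisotropicMeanCurvature_eq hF ho hfr hU] at hH
  set σ := anisoDist F Ω x with hσ
  set A := fderiv ℝ (gradient F) (unitNormal ρ y) with hA
  have hρ : ρ (y + σ • e) = σ := by rw [c.add_smul, c.eq_zero_of_mem_frontier ho hfr hU, zero_add]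
  have hn : fderiv ℝ (finslerNormal F ρ) (y + σ • e) = A.comp (shapeOperator ρ y) := by
    have h1 := fderiv_comp_add_right (𝕜 := ℝ) (f := finslerNormal F ρ) (x := y) (σ • e)
    simp_rw [c.finslerNormal_add_smul] at h1
    rw [← h1]
    exact (c.hasFDerivAt_finslerNormal hF y).fderiv
  have hm : ∀ v, fderiv ℝ ρ (y + σ • e) v = -(‖gradient ρ y‖ * ⟪unitNormal ρ y, v⟫) := fun v => by
    rw [← inner_gradient_left, c.gradient_add_smul, c.gradient_eq_smul_unitNormal y,
      inner_neg_left, real_inner_smul_left, norm_neg, norm_smul, c.norm_unitNormal]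
    simp
  have hker : ∀ v, fderiv ℝ ρ (y + σ • e) ((σ • A.comp (shapeOperator ρ y)) v) = 0 := fun v => by
    rw [hm, _root_.smul_apply, inner_smul_right, ContinuousLinearMap.comp_apply, real_inner_comm,
      hF.inner_hessian_self_right hν]
    simp
  have hw : fderiv ℝ ρ (y + σ • e) (e + finslerNormal F ρ y) =
      1 - ‖gradient ρ y‖ * F (unitNormal ρ y) := by
    rw [_root_.map_add, hm (finslerNormal F ρ y), ← inner_gradient_left, c.inner_gradient_axis,
      finslerNormal, real_inner_comm, hF.inner_gradient_self hν]
    ring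
  rw [normalMapDeriv, hρ, hn, c.finslerNormal_add_smul, det_id_sub_smulRight_sub hker, hw,
    sub_sub_cancel, abs_mul, surfaceDensity]
  have hdens : unitNormal ρ (y + σ • e) = unitNormal ρ y := by
    simp only [unitNormal, c.gradient_add_smul]
  rw [hdens, c.gradient_add_smul,
    abs_of_nonneg (mul_nonneg (norm_nonneg _) (hF.nonneg (unitNormal ρ y)))]
  refine mul_le_of_le_one_right (mul_nonneg (norm_nonneg _) (hF.nonneg _)) ?_
  have hcomp : ((σ • A.comp (shapeOperator ρ y) : EuclideanSpace ℝ (Fin N) →L[ℝ] _) :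
      EuclideanSpace ℝ (Fin N) →ₗ[ℝ] EuclideanSpace ℝ (Fin N)) =
      (A : EuclideanSpace ℝ (Fin N) →ₗ[ℝ] _) ∘ₗ
        (σ • (shapeOperator ρ y : EuclideanSpace ℝ (Fin N) →ₗ[ℝ] _)) := by
    ext1 v
    simp
  rw [hcomp]
  refine abs_det_one_sub_comp_le_one ⟨fun v w => hF.inner_hessian_comm hν v w,
    fun v => hF.inner_hessian_nonneg hν v⟩ ?_ (fun v => ?_) ?_
  · exact (c.isSymmetric_shapeOperator y).smul (by simp)
  · simpa [real_inner_smul_left] using hsecond v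
  · rw [LinearMap.comp_smul, map_smul]
    exact smul_nonneg hpos.le hH

theorem volume_tube_le_lintegral_slab (c : IsGraphChart Ω e ρ U) (hF : IsFinslerNorm p F)
    (ho : IsOpen Ω) (hH : ∀ y ∈ frontier Ω, 0 ≤ anisotropicMeanCurvature F Ω y)
    (hA : MeasurableSet A) (hAU : A ⊆ U) :
    volume (tube F Ω A s) ≤ ∫⁻ z in slab e ρ A s, ENNReal.ofReal (surfaceDensity F ρ z) := by
  -- The parameters at which the Jacobian bound holds form a measurable set that still covers the
  -- tube.
  set G := slab e ρ A s ∩ {z | |(normalMapDeriv F e ρ z).det| ≤ surfaceDensity F ρ z} with hG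
  have hGm : MeasurableSet G := (c.measurableSet_slab hA).inter
    (isClosed_le (c.continuous_det_normalMapDeriv hF).abs
      (c.continuous_surfaceDensity hF)).measurableSet
  have hsub : tube F Ω A s ⊆ normalMap F e ρ '' G := by
    rintro x ⟨hx, hs, y, hyA, hy, hxy⟩
    have hyU := hAU hyA
    have hfr := hF.mem_frontier_of_anisoDist_eq ho hx hy hxy
    have hρ : ρ (y + anisoDist F Ω x • e) = anisoDist F Ω x := by
      rw [c.add_smul, c.eq_zero_of_mem_frontier ho hfr hyU, zero_add]
    refine ⟨y + anisoDist F Ω x • e, ⟨⟨?_, ?_, ?_⟩,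
      c.abs_det_normalMapDeriv_le hF ho (hH y hfr) hx hy hyU hxy⟩, ?_⟩
    · rwa [hρ, add_sub_cancel_right]
    · rw [hρ]
      exact hF.anisoDist_pos hx hy hxy
    · rwa [hρ]
    · rw [normalMap, hρ, c.finslerNormal_add_smul, smul_add, ← sub_sub, add_sub_cancel_right]
      exact (c.eq_sub_smul_finslerNormal hF ho hx hy hyU hxy).symm
  calc volume (tube F Ω A s) ≤ volume (normalMap F e ρ '' G) := measure_mono hsub
    _ ≤ ∫⁻ z in G, ENNReal.ofReal |(normalMapDeriv F e ρ z).det| :=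
        addHaar_image_le_lintegral_abs_det_fderiv volume hGm
          fun z _ => (c.hasFDerivAt_normalMap hF z).hasFDerivWithinAt
    _ ≤ ∫⁻ z in G, ENNReal.ofReal (surfaceDensity F ρ z) :=
        setLIntegral_mono_ae' hGm (Eventually.of_forall fun z hz => ENNReal.ofReal_le_ofReal hz.2)
    _ ≤ ∫⁻ z in slab e ρ A s, ENNReal.ofReal (surfaceDensity F ρ z) :=
        lintegral_mono_set inter_subset_left

theorem hasFDerivAt_flatten (c : IsGraphChart Ω e ρ U) (ν z : EuclideanSpace ℝ (Fin N)) :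
    HasFDerivAt (flatten e ν ρ) (flattenDeriv e ν (fderiv ℝ ρ z)) z := by
  have h1 : HasFDerivAt ρ (fderiv ℝ ρ z) z := (c.contDiff.differentiable (by norm_num) z).hasFDerivAt
  have h2 : HasFDerivAt (fun z => z - ρ z • e)
      (ContinuousLinearMap.id ℝ _ - (fderiv ℝ ρ z).smulRight e) z :=
    (hasFDerivAt_id z).sub (h1.smul_const e)
  have h3 := ((innerSL ℝ ν).hasFDerivAt.comp z h2).smul_const ν
  exact (h2.sub h3).add (h1.smul_const ν)

theorem abs_det_flattenDeriv (c : IsGraphChart Ω e ρ U) (y : EuclideanSpace ℝ (Fin N)) :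
    |(flattenDeriv e (unitNormal ρ y) (fderiv ℝ ρ y)).det| = ‖gradient ρ y‖ := by
  set ν := unitNormal ρ y with hν
  set m := fderiv ℝ ρ y with hm
  have hk := (c.norm_gradient_pos y).ne'
  -- `ν` is a negative multiple of `∇ρ`, which reduces the derivative to `1 - m ⊗ (e - ν)`.
  have hinner : ∀ v, ⟪ν, v⟫ = -(‖gradient ρ y‖⁻¹ * m v) := fun v => by
    rw [hν, unitNormal, inner_neg_left, real_inner_smul_left, inner_gradient_left]
  have hme : m e = 1 := by rw [hm, ← inner_gradient_left, c.inner_gradient_axis]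
  have hmν : m ν = -‖gradient ρ y‖ := by
    have := hinner ν
    rw [real_inner_self_eq_norm_sq, c.norm_unitNormal] at this
    field_simp at this
    linarith
  have h : flattenDeriv e ν m = ContinuousLinearMap.id ℝ _ - m.smulRight (e - ν) - 0 := by
    ext1 v
    have : m (v - m v • e) = 0 := by rw [map_sub, map_smul, hme, smul_eq_mul, mul_one, sub_self]
    simp only [flattenDeriv, _root_.add_apply, _root_.sub_apply,
      ContinuousLinearMap.id_apply, ContinuousLinearMap.smulRight_apply,
      ContinuousLinearMap.comp_apply, innerSL_apply_apply, hinner, this]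
    simp only [mul_zero, neg_zero, zero_smul, sub_zero, _root_.zero_apply, smul_sub]
    abel
  rw [h, det_id_sub_smulRight_sub (by simp)]
  simp [hme, hmν]

/-- The image of the slab under `flatten` is contained in a cylinder of height `s` over the
projection of `A` to `νᗮ`. The hypothesis says that this projection is injective on `A`. -/
theorem lintegral_slab_det_flattenDeriv_le (c : IsGraphChart Ω e ρ U)
    {ν : EuclideanSpace ℝ (Fin N)} (hν : ‖ν‖ = 1) (hA : MeasurableSet A)
    (hinj : ∀ x ∈ A, ∀ y ∈ A, ⟪ν, x - y⟫ • ν = x - y → x = y) :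
    ∫⁻ z in slab e ρ A s, ENNReal.ofReal |(flattenDeriv e ν (fderiv ℝ ρ z)).det| ≤
      ENNReal.ofReal s * μHE[N - 1] A := by
  have hνν : ⟪ν, ν⟫ = (1 : ℝ) := by rw [real_inner_self_eq_norm_sq, hν]; norm_num
  have hheight : ∀ z, ⟪ν, flatten e ν ρ z⟫ = ρ z := fun z => by
    rw [flatten, inner_add_right, inner_sub_right, inner_smul_right, inner_smul_right, hνν]
    ring
  have hinjOn : InjOn (flatten e ν ρ) (slab e ρ A s) := by
    intro z hz w hw hzw
    have h1 : ρ z = ρ w := by rw [← hheight z, hzw, hheight w]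
    have h2 : z - ρ z • e = w - ρ w • e := by
      refine hinj _ hz.1 _ hw.1 ?_
      simp only [flatten, h1, add_left_inj] at hzw
      rw [h1, inner_sub_right, sub_smul]
      exact (sub_eq_zero.mp (by rw [← sub_eq_zero.mpr hzw]; abel)).symm
    rw [h1] at h2
    exact sub_left_injective h2
  rw [lintegral_abs_det_fderiv_eq_addHaar_image volume (c.measurableSet_slab hA)
    (fun z _ => (c.hasFDerivAt_flatten ν z).hasFDerivWithinAt) hinjOn]
  have := volume_le_of_forall_mem_hyperplane hν (J := Ioo 0 s) (A := A)
    (S := flatten e ν ρ '' slab e ρ A s) (by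
      rintro _ ⟨z, hz, rfl⟩
      refine ⟨by rw [hheight]; exact hz.2, _, hz.1, ?_⟩
      rw [flatten, _root_.map_add, map_sub]
      have h0 : ∀ t : ℝ, (ℝ ∙ ν)ᗮ.orthogonalProjectionOnto (t • ν) = 0 := fun t => by
        rw [Submodule.orthogonalProjectionOnto_eq_zero_iff, Submodule.orthogonal_orthogonal]
        exact Submodule.smul_mem _ _ (Submodule.mem_span_singleton_self ν)
      rw [h0, h0, sub_zero, add_zero])
  rwa [Real.volume_Ioo, sub_zero, finrank_euclideanSpace_fin] at this

end IsGraphChart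

end Tube

/-! ### Volume of the tube over the whole boundary -/

section TubeVolume

variable {N : ℕ} {p : ℝ} {F : EuclideanSpace ℝ (Fin N) → ℝ} {Ω : Set (EuclideanSpace ℝ (Fin N))}
  {e : EuclideanSpace ℝ (Fin N)} {ρ : EuclideanSpace ℝ (Fin N) → ℝ}
  {U A : Set (EuclideanSpace ℝ (Fin N))} {x y z : EuclideanSpace ℝ (Fin N)} {s δ : ℝ}

/-- Near a boundary point the boundary is almost flat: its chords make a small angle with the
tangent hyperplane. -/
theorem IsGraphChart.eventually_abs_inner_le (c : IsGraphChart Ω e ρ U)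
    (y : EuclideanSpace ℝ (Fin N)) :
    ∃ W ∈ 𝓝 y, ∀ x ∈ W, ∀ z ∈ W, ρ x = 0 → ρ z = 0 →
      |⟪unitNormal ρ y, x - z⟫| ≤ ‖x - z‖ / 2 := by
  have hk := c.norm_gradient_pos y
  have h1 : HasStrictFDerivAt ρ (fderiv ℝ ρ y) y :=
    c.contDiff.contDiffAt.hasStrictFDerivAt (by norm_num)
  obtain ⟨W, hW, h2⟩ := h1.approximates_deriv_on_nhds (c := (‖gradient ρ y‖ / 2).toNNReal)
    (Or.inr (Real.toNNReal_pos.mpr (half_pos hk)))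
  refine ⟨W, hW, fun x hx z hz hρx hρz => ?_⟩
  have h3 := h2 x hx z hz
  rw [hρx, hρz, sub_zero, zero_sub, norm_neg, Real.norm_eq_abs,
    Real.coe_toNNReal _ (half_pos hk).le] at h3
  rw [unitNormal, inner_neg_left, abs_neg, real_inner_smul_left, inner_gradient_left, abs_mul,
    abs_inv, abs_norm, inv_mul_le_iff₀ hk]
  linarith

/-- Near a boundary point, the density of the anisotropic surface measure in graph coordinates
agrees up to a factor close to `1` with `F(ν)` times the Jacobian of the flattening map at the
point, and the projection to the tangent hyperplane does not increase Hausdorff measure. -/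
theorem IsGraphChart.exists_nhds_lintegral_slab_le (c : IsGraphChart Ω e ρ U)
    (hF : IsFinslerNorm p F) (ho : IsOpen Ω) (hU : y ∈ U) (hδ : 0 < δ) :
    ∃ W, IsOpen W ∧ y ∈ W ∧ W ⊆ U ∧ μHE[N - 1] (W ∩ frontier Ω) < ⊤ ∧
      ∀ A, MeasurableSet A → A ⊆ W ∩ frontier Ω → ∀ s,
        ∫⁻ z in slab e ρ A s, ENNReal.ofReal (surfaceDensity F ρ z) ≤
          ENNReal.ofReal ((1 + δ) ^ 2) * (ENNReal.ofReal s *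
            ∫⁻ z in A, ENNReal.ofReal (F (outerNormal Ω z)) ∂μHE[N - 1]) := by
  set ν := unitNormal ρ y with hν
  have hν1 : ‖ν‖ = 1 := c.norm_unitNormal y
  have hν0 : ν ≠ 0 := c.unitNormal_ne_zero y
  set κ := F ν with hκ
  have hκpos : 0 < κ := hF.pos hν0
  set J : EuclideanSpace ℝ (Fin N) → ℝ := fun z => |(flattenDeriv e ν (fderiv ℝ ρ z)).det| with hJ
  have hJc : Continuous J := by
    have h1 : Continuous (fderiv ℝ ρ) := c.contDiff.continuous_fderiv (by norm_num)
    refine (ContinuousLinearMap.continuous_det.comp ?_).abs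
    unfold flattenDeriv
    fun_prop
  have hJy : J y = ‖gradient ρ y‖ := c.abs_det_flattenDeriv y
  have hNc : Continuous fun z => F (unitNormal ρ z) :=
    hF.continuous.comp c.contDiff_unitNormal.continuous
  have hgood1 : ∀ᶠ z in 𝓝 y, surfaceDensity F ρ z < (1 + δ) * κ * J z := by
    refine (c.continuous_surfaceDensity hF).continuousAt.eventually_lt
      (continuous_const.mul hJc).continuousAt ?_
    rw [hJy, surfaceDensity, ← hν, ← hκ]
    nlinarith [mul_pos hκpos (c.norm_gradient_pos y)]
  have hgood2 : ∀ᶠ z in 𝓝 y, κ < (1 + δ) * F (unitNormal ρ z) := by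
    refine continuousAt_const.eventually_lt (continuous_const.mul hNc).continuousAt ?_
    rw [← hν, ← hκ]
    nlinarith
  obtain ⟨V, hV, hflat⟩ := c.eventually_abs_inner_le y
  have hnhds : ∀ᶠ z in 𝓝 y, z ∈ V ∧ z ∈ U ∧ z ∈ Metric.ball y 1 ∧
      surfaceDensity F ρ z < (1 + δ) * κ * J z ∧ κ < (1 + δ) * F (unitNormal ρ z) := by
    filter_upwards [hV, c.isOpen.mem_nhds hU, Metric.ball_mem_nhds y one_pos, hgood1, hgood2]
      with z h1 h2 h3 h4 h5
    exact ⟨h1, h2, h3, h4, h5⟩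
  obtain ⟨W, hWsub, hWo, hyW⟩ := mem_nhds_iff.mp hnhds
  have hchord : ∀ x ∈ W ∩ frontier Ω, ∀ z ∈ W ∩ frontier Ω, |⟪ν, x - z⟫| ≤ ‖x - z‖ / 2 :=
    fun x hx z hz => hflat x (hWsub hx.1).1 z (hWsub hz.1).1
      (c.eq_zero_of_mem_frontier ho hx.2 (hWsub hx.1).2.1)
      (c.eq_zero_of_mem_frontier ho hz.2 (hWsub hz.1).2.1)
  refine ⟨W, hWo, hyW, fun z hz => (hWsub hz).2.1, ?_, fun A hA hAW s => ?_⟩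
  · have hb : Bornology.IsBounded (W ∩ frontier Ω) :=
      Metric.isBounded_ball.subset fun z hz => (hWsub hz.1).2.2.1
    have := euclideanHausdorffMeasure_lt_top_of_norm_le_projection hν0 hb (C := 2)
      fun x hx z hz => by
        have h1 := hchord x hx z hz
        have h2 : x - z = ⟪ν, x - z⟫ • ν + ((ℝ ∙ ν)ᗮ.orthogonalProjectionOnto (x - z) :
            EuclideanSpace ℝ (Fin N)) := by
          rw [← Submodule.starProjection_unit_singleton ℝ hν1 (x - z)]
          exact (Submodule.starProjection_add_starProjection_orthogonal (K := ℝ ∙ ν) (x - z)).symm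
        have h3 : ‖x - z‖ ≤ |⟪ν, x - z⟫| + ‖(ℝ ∙ ν)ᗮ.orthogonalProjectionOnto (x - z)‖ := by
          conv_lhs => rw [h2]
          refine (norm_add_le _ _).trans ?_
          rw [norm_smul, hν1, mul_one, Real.norm_eq_abs, Submodule.norm_coe]
        rw [← map_sub, NNReal.coe_ofNat]
        linarith
    rwa [finrank_euclideanSpace_fin] at this
  -- Both densities are constant along `e`, so that it is enough to compare them on `A`.
  have hslab : ∀ z ∈ slab e ρ A s, surfaceDensity F ρ z ≤ (1 + δ) * κ * J z := fun z hz => by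
    have h1 := (hWsub (hAW hz.1).1).2.2.2.1.le
    have h2 : gradient ρ (z - ρ z • e) = gradient ρ z := by
      rw [sub_eq_add_neg, ← neg_smul, c.gradient_add_smul]
    have h3 : fderiv ℝ ρ (z - ρ z • e) = fderiv ℝ ρ z := by
      rw [← toDual_gradient, ← toDual_gradient, h2]
    simpa only [surfaceDensity, unitNormal, hJ, h2, h3] using h1
  have hinj : ∀ x ∈ A, ∀ z ∈ A, ⟪ν, x - z⟫ • ν = x - z → x = z := fun x hx z hz h => by
    have h1 := hchord x (hAW hx) z (hAW hz)
    have h2 : |⟪ν, x - z⟫| = ‖x - z‖ := by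
      conv_rhs => rw [← h, norm_smul, hν1, mul_one, Real.norm_eq_abs]
    have h3 : ‖x - z‖ ≤ 0 := by linarith
    exact sub_eq_zero.mp (norm_le_zero_iff.mp h3)
  have hA1 : ENNReal.ofReal κ * μHE[N - 1] A ≤ ENNReal.ofReal (1 + δ) *
      ∫⁻ z in A, ENNReal.ofReal (F (outerNormal Ω z)) ∂μHE[N - 1] := by
    rw [← setLIntegral_const, ← lintegral_const_mul' _ _ ENNReal.ofReal_ne_top]
    refine setLIntegral_mono_ae' hA (Eventually.of_forall fun z hz => ?_)
    rw [← ENNReal.ofReal_mul (by positivity),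
      c.outerNormal_eq ho (hAW hz).2 (hWsub (hAW hz).1).2.1]
    exact ENNReal.ofReal_le_ofReal (hWsub (hAW hz).1).2.2.2.2.le
  calc ∫⁻ z in slab e ρ A s, ENNReal.ofReal (surfaceDensity F ρ z)
      ≤ ∫⁻ z in slab e ρ A s, ENNReal.ofReal ((1 + δ) * κ) * ENNReal.ofReal (J z) := by
        refine setLIntegral_mono_ae' (c.measurableSet_slab hA)
          (Eventually.of_forall fun z hz => ?_)
        rw [← ENNReal.ofReal_mul (by positivity)]
        exact ENNReal.ofReal_le_ofReal (hslab z hz)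
    _ = ENNReal.ofReal ((1 + δ) * κ) * ∫⁻ z in slab e ρ A s, ENNReal.ofReal (J z) :=
        lintegral_const_mul' _ _ ENNReal.ofReal_ne_top
    _ ≤ ENNReal.ofReal ((1 + δ) * κ) * (ENNReal.ofReal s * μHE[N - 1] A) := by
        gcongr
        exact c.lintegral_slab_det_flattenDeriv_le hν1 hA hinj
    _ = ENNReal.ofReal (1 + δ) * (ENNReal.ofReal s * (ENNReal.ofReal κ * μHE[N - 1] A)) := by
        rw [ENNReal.ofReal_mul (by positivity)]
        ring
    _ ≤ ENNReal.ofReal (1 + δ) * (ENNReal.ofReal s * (ENNReal.ofReal (1 + δ) *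
          ∫⁻ z in A, ENNReal.ofReal (F (outerNormal Ω z)) ∂μHE[N - 1])) := by gcongr
    _ = _ := by
        rw [pow_two, ENNReal.ofReal_mul (by positivity)]
        ring

theorem IsBoundedC2Domain.isCompact_frontier (hΩ : IsBoundedC2Domain Ω) :
    IsCompact (frontier Ω) :=
  Metric.isCompact_of_isClosed_isBounded isClosed_frontier
    (hΩ.isBounded.closure.subset frontier_subset_closure)

theorem IsBoundedC2Domain.nonempty_compl (hΩ : IsBoundedC2Domain Ω) (hN : 0 < N) :
    Ωᶜ.Nonempty := by
  rw [Set.nonempty_compl]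
  rintro rfl
  have : Nontrivial (EuclideanSpace ℝ (Fin N)) := by
    have : Nonempty (Fin N) := ⟨⟨0, hN⟩⟩
    infer_instance
  exact NormedSpace.unbounded_univ ℝ (EuclideanSpace ℝ (Fin N)) hΩ.isBounded

theorem IsBoundedC2Domain.surfaceMeasure_lt_top (hΩ : IsBoundedC2Domain Ω)
    (hF : IsFinslerNorm p F) : surfaceMeasure Ω univ < ⊤ := by
  have key : μHE[N - 1] (frontier Ω ∩ frontier Ω) < ⊤ := by
    refine hΩ.isCompact_frontier.induction_on (p := fun S => μHE[N - 1] (S ∩ frontier Ω) < ⊤)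
      ?_ ?_ ?_ ?_
    · simp
    · exact fun S T hST hT => (measure_mono (inter_subset_inter_left _ hST)).trans_lt hT
    · intro S T hS hT
      rw [union_inter_distrib_right]
      exact measure_union_lt_top hS hT
    · intro y hy
      obtain ⟨e, ρ, U, hU, c⟩ := hΩ.boundary.exists_isGraphChart hy
      obtain ⟨W, hWo, hyW, -, hfin, -⟩ :=
        c.exists_nhds_lintegral_slab_le hF hΩ.isOpen hU one_pos
      exact ⟨W, mem_nhdsWithin_of_mem_nhds (hWo.mem_nhds hyW), hfin⟩
  rwa [inter_self, ← Measure.restrict_apply_univ] at key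

theorem tube_union_subset (F : EuclideanSpace ℝ (Fin N) → ℝ)
    (Ω A B : Set (EuclideanSpace ℝ (Fin N))) (s : ℝ) :
    tube F Ω (A ∪ B) s ⊆ tube F Ω A s ∪ tube F Ω B s := by
  rintro x ⟨hx, hs, y, hy | hy, h⟩
  · exact Or.inl ⟨hx, hs, y, hy, h⟩
  · exact Or.inr ⟨hx, hs, y, hy, h⟩

/-- On a domain with nonnegative anisotropic mean curvature, the anisotropic tube of width `s`
inside `Ω` has at most `s` times the anisotropic perimeter as volume. -/
theorem IsBoundedC2Domain.volume_anisoDist_lt_le (hΩ : IsBoundedC2Domain Ω)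
    (hF : IsFinslerNorm p F) (hN : 0 < N)
    (hH : ∀ y ∈ frontier Ω, 0 ≤ anisotropicMeanCurvature F Ω y) (s : ℝ) :
    volume {x | x ∈ Ω ∧ anisoDist F Ω x < s} ≤
      ENNReal.ofReal s * ∫⁻ z, ENNReal.ofReal (F (outerNormal Ω z)) ∂surfaceMeasure Ω := by
  set I := ∫⁻ z, ENNReal.ofReal (F (outerNormal Ω z)) ∂surfaceMeasure Ω with hI
  have key : ∀ δ : ℝ, 0 < δ → volume (tube F Ω (frontier Ω) s) ≤
      ENNReal.ofReal ((1 + δ) ^ 2) * (ENNReal.ofReal s * I) := by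
    intro δ hδ
    have hind : ∃ M, MeasurableSet M ∧ frontier Ω ⊆ M ∧ ∀ A, MeasurableSet A →
        A ⊆ M ∩ frontier Ω → volume (tube F Ω A s) ≤ ENNReal.ofReal ((1 + δ) ^ 2) *
          (ENNReal.ofReal s *
            ∫⁻ z in A, ENNReal.ofReal (F (outerNormal Ω z)) ∂μHE[N - 1]) := by
      refine hΩ.isCompact_frontier.induction_on (p := fun S => ∃ M, MeasurableSet M ∧ S ⊆ M ∧
        ∀ A, MeasurableSet A → A ⊆ M ∩ frontier Ω → volume (tube F Ω A s) ≤
          ENNReal.ofReal ((1 + δ) ^ 2) * (ENNReal.ofReal s *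
            ∫⁻ z in A, ENNReal.ofReal (F (outerNormal Ω z)) ∂μHE[N - 1])) ?_ ?_ ?_ ?_
      · refine ⟨∅, MeasurableSet.empty, Subset.rfl, fun A _ hA => ?_⟩
        have hA' : A = ∅ := by simpa using hA
        have h0 : tube F Ω A s = ∅ := by
          ext x
          simp [tube, hA']
        simp [h0]
      · rintro S T hST ⟨M, hM, hTM, h⟩
        exact ⟨M, hM, hST.trans hTM, h⟩
      · rintro S T ⟨M, hM, hSM, h⟩ ⟨M', hM', hTM', h'⟩
        refine ⟨M ∪ M', hM.union hM', union_subset_union hSM hTM', fun A hA hAM => ?_⟩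
        have h1 := h (A ∩ M) (hA.inter hM) fun z hz => ⟨hz.2, (hAM hz.1).2⟩
        have h2 := h' (A \ M) (hA.diff hM) fun z hz =>
          ⟨(hAM hz.1).1.resolve_left hz.2, (hAM hz.1).2⟩
        rw [← inter_union_sdiff A M]
        refine (measure_mono (tube_union_subset F Ω _ _ s)).trans ((measure_union_le _ _).trans ?_)
        rw [lintegral_union (hA.diff hM) (disjoint_sdiff_inter.symm), mul_add, mul_add]
        exact add_le_add h1 h2
      · intro y hy
        obtain ⟨e, ρ, U, hU, c⟩ := hΩ.boundary.exists_isGraphChart hy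
        obtain ⟨W, hWo, hyW, hWU, -, hW⟩ :=
          c.exists_nhds_lintegral_slab_le hF hΩ.isOpen hU hδ
        refine ⟨W, mem_nhdsWithin_of_mem_nhds (hWo.mem_nhds hyW), W, hWo.measurableSet,
          Subset.rfl, fun A hA hAW => ?_⟩
        exact (c.volume_tube_le_lintegral_slab hF hΩ.isOpen hH hA
          fun z hz => hWU (hAW hz).1).trans (hW A hA hAW s)
    obtain ⟨M, -, hsub, h⟩ := hind
    exact h (frontier Ω) isClosed_frontier.measurableSet fun z hz => ⟨hsub hz, hz⟩
  have hsub : {x | x ∈ Ω ∧ anisoDist F Ω x < s} ⊆ tube F Ω (frontier Ω) s := by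
    rintro x ⟨hx, hs⟩
    obtain ⟨y, hy, hxy⟩ := hF.exists_anisoDist_eq hΩ.isOpen (hΩ.nonempty_compl hN) x
    exact ⟨hx, hs, y, hF.mem_frontier_of_anisoDist_eq hΩ.isOpen hx hy hxy, hy, hxy⟩
  refine (measure_mono hsub).trans ?_
  have hlim : Tendsto (fun δ : ℝ => ENNReal.ofReal ((1 + δ) ^ 2) * (ENNReal.ofReal s * I))
      (𝓝[>] 0) (𝓝 (1 * (ENNReal.ofReal s * I))) := by
    refine ENNReal.Tendsto.mul_const ?_ (Or.inl one_ne_zero)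
    have hc : Continuous fun δ : ℝ => ENNReal.ofReal ((1 + δ) ^ 2) :=
      ENNReal.continuous_ofReal.comp (by fun_prop)
    have := hc.tendsto 0
    simp only [add_zero, one_pow, ENNReal.ofReal_one] at this
    exact this.mono_left nhdsWithin_le_nhds
  rw [one_mul] at hlim
  refine ge_of_tendsto hlim ?_
  filter_upwards [self_mem_nhdsWithin] with δ hδ
  exact key δ hδ

end TubeVolume

/-! ### Integrals over the domain and its boundary -/

section Integrals

variable {N : ℕ} {p : ℝ} {F : EuclideanSpace ℝ (Fin N) → ℝ} {Ω : Set (EuclideanSpace ℝ (Fin N))}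

theorem ofReal_exp_eq_lintegral {q : ℝ} (hq : 0 < q) (a : ℝ) :
    ENNReal.ofReal (Real.exp (-q * a)) =
      ∫⁻ s in Ioi a, ENNReal.ofReal (q * Real.exp (-q * s)) := by
  rw [← ofReal_integral_eq_lintegral_ofReal
    ((integrableOn_exp_mul_Ioi (neg_neg_of_pos hq) a).const_mul q)
    (Eventually.of_forall fun s => by positivity)]
  rw [integral_const_mul, integral_exp_mul_Ioi (neg_neg_of_pos hq)]
  congr 1
  field_simp

theorem lintegral_mul_exp {q : ℝ} (hq : 0 < q) :
    ∫⁻ s in Ioi 0, ENNReal.ofReal (q * Real.exp (-q * s)) * ENNReal.ofReal s =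
      ENNReal.ofReal (1 / q) := by
  have h1 : ∫ s in Ioi (0 : ℝ), s ^ ((2 : ℝ) - 1) * Real.exp (-(q * s)) = (1 / q) ^ (2 : ℝ) := by
    rw [Real.integral_rpow_mul_exp_neg_mul_Ioi two_pos hq, Real.Gamma_two, mul_one]
  have h2 : IntegrableOn (fun s : ℝ => s ^ ((2 : ℝ) - 1) * Real.exp (-(q * s))) (Ioi 0) := by
    by_contra hcon
    rw [integral_undef hcon] at h1
    exact (by positivity : (0 : ℝ) < (1 / q) ^ (2 : ℝ)).ne h1
  have h3 : ∫ s in Ioi (0 : ℝ), q * (s ^ ((2 : ℝ) - 1) * Real.exp (-(q * s))) = 1 / q := by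
    rw [integral_const_mul, h1, Real.rpow_two]
    field_simp
  rw [← h3, ofReal_integral_eq_lintegral_ofReal (h2.const_mul q)]
  · refine setLIntegral_congr_fun measurableSet_Ioi fun s hs => ?_
    have hs : 0 < s := hs
    rw [← ENNReal.ofReal_mul (by positivity)]
    congr 1
    rw [show (2 : ℝ) - 1 = 1 by norm_num, Real.rpow_one, neg_mul]
    ring
  · filter_upwards [self_mem_ae_restrict measurableSet_Ioi] with s hs
    have hs : 0 < s := hs
    simp only [Pi.zero_apply]
    positivity

/-- Layer-cake integration of the tube bound. -/
theorem IsBoundedC2Domain.lintegral_exp_anisoDist_le (hΩ : IsBoundedC2Domain Ω)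
    (hF : IsFinslerNorm p F) (hN : 0 < N)
    (hH : ∀ y ∈ frontier Ω, 0 ≤ anisotropicMeanCurvature F Ω y) {q : ℝ} (hq : 0 < q) :
    ∫⁻ x in Ω, ENNReal.ofReal (Real.exp (-q * anisoDist F Ω x)) ≤
      ENNReal.ofReal (1 / q) *
        ∫⁻ z, ENNReal.ofReal (F (outerNormal Ω z)) ∂surfaceMeasure Ω := by
  set I := ∫⁻ z, ENNReal.ofReal (F (outerNormal Ω z)) ∂surfaceMeasure Ω with hI
  obtain ⟨K, hK⟩ := hF.exists_lipschitzWith_anisoDist (hΩ.nonempty_compl hN)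
  set d := anisoDist F Ω with hd
  set g : ℝ → ℝ≥0∞ := fun s => ENNReal.ofReal (q * Real.exp (-q * s)) with hg
  have hgm : Measurable g := by fun_prop
  have hset : MeasurableSet {w : EuclideanSpace ℝ (Fin N) × ℝ | d w.1 < w.2} :=
    measurableSet_lt (hK.continuous.measurable.comp measurable_fst) measurable_snd
  calc ∫⁻ x in Ω, ENNReal.ofReal (Real.exp (-q * d x))
      = ∫⁻ x in Ω, ∫⁻ s in Ioi 0, {w : EuclideanSpace ℝ (Fin N) × ℝ | d w.1 < w.2}.indicator
          (fun w => g w.2) (x, s) := by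
        refine lintegral_congr fun x => ?_
        rw [ofReal_exp_eq_lintegral hq, ← Measure.restrict_restrict_of_subset
          (Ioi_subset_Ioi (hF.anisoDist_nonneg x)), ← lintegral_indicator measurableSet_Ioi]
        rfl
    _ = ∫⁻ s in Ioi 0, ∫⁻ x in Ω, {w : EuclideanSpace ℝ (Fin N) × ℝ | d w.1 < w.2}.indicator
          (fun w => g w.2) (x, s) :=
        lintegral_lintegral_swap ((hgm.comp measurable_snd).indicator hset).aemeasurable
    _ = ∫⁻ s in Ioi 0, g s * volume {x | x ∈ Ω ∧ d x < s} := by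
        refine lintegral_congr fun s => ?_
        have hm : MeasurableSet {x | d x < s} :=
          measurableSet_lt hK.continuous.measurable measurable_const
        calc ∫⁻ x in Ω, {w : EuclideanSpace ℝ (Fin N) × ℝ | d w.1 < w.2}.indicator
              (fun w => g w.2) (x, s) = ∫⁻ x in Ω, {x | d x < s}.indicator (fun _ => g s) x := rfl
          _ = g s * volume {x | x ∈ Ω ∧ d x < s} := by
            rw [lintegral_indicator hm, Measure.restrict_restrict hm, setLIntegral_const,
              inter_comm]
            rfl
    _ ≤ ∫⁻ s in Ioi 0, g s * ENNReal.ofReal s * I := by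
        refine lintegral_mono fun s => ?_
        rw [mul_assoc]
        exact mul_le_mul_right (hΩ.volume_anisoDist_lt_le hF hN hH s) (g s)
    _ = ENNReal.ofReal (1 / q) * I := by
        rw [lintegral_mul_const _ (by fun_prop), lintegral_mul_exp hq]

theorem IsBoundedC2Domain.continuousOn_outerNormal (hΩ : IsBoundedC2Domain Ω) :
    ContinuousOn (outerNormal Ω) (frontier Ω) := by
  intro y hy
  obtain ⟨e, ρ, U, hU, c⟩ := hΩ.boundary.exists_isGraphChart hy
  refine (c.contDiff_unitNormal.continuous.continuousAt.continuousWithinAt).congr_of_eventuallyEq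
    ?_ (c.outerNormal_eq hΩ.isOpen hy hU)
  filter_upwards [self_mem_nhdsWithin, mem_nhdsWithin_of_mem_nhds (c.isOpen.mem_nhds hU)]
    with x hx hxU
  exact c.outerNormal_eq hΩ.isOpen hx hxU

theorem IsBoundedC2Domain.integrable_mul_outerNormal (hΩ : IsBoundedC2Domain Ω)
    (hF : IsFinslerNorm p F) {h : EuclideanSpace ℝ (Fin N) → ℝ} (hh : Continuous h) :
    Integrable (fun z => h z * F (outerNormal Ω z)) (surfaceMeasure Ω) := by
  have hc : ContinuousOn (fun z => h z * F (outerNormal Ω z)) (frontier Ω) :=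
    hh.continuousOn.mul (hF.continuous.comp_continuousOn hΩ.continuousOn_outerNormal)
  obtain ⟨C, hC⟩ := hΩ.isCompact_frontier.exists_bound_of_continuousOn hc
  have : IsFiniteMeasure (surfaceMeasure Ω) := ⟨hΩ.surfaceMeasure_lt_top hF⟩
  refine Integrable.of_bound (hc.aestronglyMeasurable isClosed_frontier.measurableSet) C ?_
  exact (ae_restrict_iff' isClosed_frontier.measurableSet).mpr (Eventually.of_forall hC)

theorem memLp_restrict_of_continuous {E : Type*} [NormedAddCommGroup E]
    [SecondCountableTopology E] (hb : Bornology.IsBounded Ω) (ho : IsOpen Ω)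
    {h : EuclideanSpace ℝ (Fin N) → E} (hh : Continuous h) (r : ℝ≥0∞) :
    MemLp h r (volume.restrict Ω) := by
  obtain ⟨C, hC⟩ := (Metric.isCompact_of_isClosed_isBounded isClosed_closure
    hb.closure).exists_bound_of_continuousOn hh.continuousOn
  have : IsFiniteMeasure (volume.restrict Ω) := ⟨by simpa using hb.measure_lt_top⟩
  refine MemLp.of_bound hh.aestronglyMeasurable C ?_
  exact (ae_restrict_iff' ho.measurableSet).mpr
    (Eventually.of_forall fun x hx => hC x (subset_closure hx))

theorem isSobolev_of_contDiff (hb : Bornology.IsBounded Ω) (ho : IsOpen Ω)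
    {u : EuclideanSpace ℝ (Fin N) → ℝ} (hu : ContDiff ℝ ∞ u) : IsSobolev p Ω u (gradient u) := by
  have hg : Continuous (gradient u) :=
    (InnerProductSpace.toDual ℝ _).symm.continuous.comp (hu.continuous_fderiv (by simp))
  refine ⟨memLp_restrict_of_continuous hb ho hu.continuous _,
    memLp_restrict_of_continuous hb ho hg _, fun φ hφ hc hsupp v => ?_⟩
  have hφ' : Continuous fun x => fderiv ℝ φ x v :=
    (hφ.continuous_fderiv (by simp)).clm_apply continuous_const
  have hu' : Continuous fun x => fderiv ℝ u x v :=
    (hu.continuous_fderiv (by simp)).clm_apply continuous_const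
  have hsub : ∀ x ∉ Ω, φ x = 0 := fun x hx =>
    image_eq_zero_of_notMem_tsupport fun h => hx (hsupp h)
  have hsub' : ∀ x ∉ Ω, fderiv ℝ φ x v = 0 := fun x hx => by
    rw [image_eq_zero_of_notMem_tsupport fun h => hx (hsupp (tsupport_fderiv_subset ℝ h))]
    rfl
  have hcφ' : HasCompactSupport fun x => fderiv ℝ φ x v := hc.fderiv_apply ℝ v
  rw [setIntegral_eq_integral_of_forall_compl_eq_zero fun x hx => by rw [hsub' x hx, mul_zero],
    setIntegral_eq_integral_of_forall_compl_eq_zero fun x hx => by rw [hsub x hx, mul_zero]]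
  simp_rw [inner_gradient_left]
  exact integral_mul_fderiv_eq_neg_fderiv_mul_of_integrable
    ((hu'.mul hφ.continuous).integrable_of_hasCompactSupport hc.mul_left)
    ((hu.continuous.mul hφ').integrable_of_hasCompactSupport hcφ'.mul_left)
    ((hu.continuous.mul hφ.continuous).integrable_of_hasCompactSupport hc.mul_left)
    (fun x _ => hu.differentiable (by simp) x) fun x _ => hφ.differentiable (by simp) x

/-- A smooth function is its own trace, the approximating sequence being constant. -/
theorem isTrace_of_contDiff {u : EuclideanSpace ℝ (Fin N) → ℝ} (hu : ContDiff ℝ ∞ u)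
    (hmem : MemLp u (ENNReal.ofReal p) (surfaceMeasure Ω)) :
    IsTrace p Ω u (gradient u) u := by
  refine ⟨hmem, fun _ => u, fun _ => hu, ?_, ?_, ?_⟩ <;> simp

end Integrals

/-! ### The test function -/

section TestFunction

variable {N : ℕ} {p : ℝ} {F : EuclideanSpace ℝ (Fin N) → ℝ} {Ω : Set (EuclideanSpace ℝ (Fin N))}

/-- By duality, a function that is `1`-Lipschitz for the dual norm has gradient of Finsler norm at
most `1`: test the derivative in the direction `∇F(∇f)`, which has dual norm at most `1`. -/
theorem IsFinslerNorm.map_gradient_le_one (hF : IsFinslerNorm p F)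
    {f : EuclideanSpace ℝ (Fin N) → ℝ} (hf : ∀ x h, f (x + h) ≤ f x + polarNorm F h)
    {x : EuclideanSpace ℝ (Fin N)} (hd : DifferentiableAt ℝ f x) : F (gradient f x) ≤ 1 := by
  by_cases h0 : gradient f x = 0
  · rw [h0, hF.map_zero]
    exact zero_le_one
  set v := gradient F (gradient f x) with hv
  have h1 : HasDerivAt (fun t : ℝ => x + t • v) v 0 := by
    simpa using ((hasDerivAt_id (0 : ℝ)).smul_const v).const_add x
  have h2 : HasFDerivAt f (fderiv ℝ f x) (x + (0 : ℝ) • v) := by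
    simpa using hd.hasFDerivAt
  have h3 := (h2.comp_hasDerivAt (0 : ℝ) h1).tendsto_slope_zero_right
  have h4 : fderiv ℝ f x v = F (gradient f x) := by
    rw [← inner_gradient_left, real_inner_comm, hv, hF.inner_gradient_self h0]
  rw [h4] at h3
  refine le_of_tendsto h3 ?_
  filter_upwards [self_mem_nhdsWithin] with t ht
  have ht : 0 < t := ht
  simp only [Function.comp_apply, zero_add, zero_smul, add_zero, smul_eq_mul]
  rw [inv_mul_le_iff₀ ht, mul_one, sub_le_iff_le_add']
  refine (hf x (t • v)).trans (add_le_add_right ?_ _)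
  refine (hF.polarNorm_smul_le ht.le v).trans ?_
  nlinarith [hF.polarNorm_gradient_le_one h0]

/-- Mollification keeps the Lipschitz property of the anisotropic distance. -/
theorem IsFinslerNorm.exists_contDiff_approx_anisoDist (hF : IsFinslerNorm p F)
    (hne : Ωᶜ.Nonempty) {ε : ℝ} (hε : 0 < ε) :
    ∃ f : EuclideanSpace ℝ (Fin N) → ℝ, ContDiff ℝ ∞ f ∧
      (∀ x, |f x - anisoDist F Ω x| ≤ ε) ∧ ∀ x, F (gradient f x) ≤ 1 := by
  obtain ⟨K, hK⟩ := hF.exists_lipschitzWith_anisoDist hne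
  set d := anisoDist F Ω with hd
  have hr : 0 < ε / (K + 1) := by positivity
  let φ : ContDiffBump (0 : EuclideanSpace ℝ (Fin N)) :=
    ⟨ε / (K + 1) / 2, ε / (K + 1), half_pos hr, half_lt_self hr⟩
  let f : EuclideanSpace ℝ (Fin N) → ℝ :=
    convolution (φ.normed volume) d (ContinuousLinearMap.lsmul ℝ ℝ) volume
  have hf : ContDiff ℝ ∞ f := φ.hasCompactSupport_normed.contDiff_convolution_left _
    φ.contDiff_normed hK.continuous.locallyIntegrable
  refine ⟨f, hf, fun x => ?_, fun x => ?_⟩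
  · rw [← Real.dist_eq]
    refine φ.dist_normed_convolution_le hK.continuous.aestronglyMeasurable fun y hy => ?_
    refine (hK.dist_le_mul y x).trans ?_
    have hy : dist y x < ε / (K + 1) := hy
    rw [lt_div_iff₀ (by positivity)] at hy
    nlinarith [dist_nonneg (x := y) (y := x)]
  · refine hF.map_gradient_le_one (fun x h => ?_) (hf.differentiable (by simp) x)
    have hint : ∀ x, Integrable fun t => φ.normed volume t * d (x - t) := fun x =>
      (φ.continuous_normed.mul (hK.continuous.comp
        (continuous_const.sub continuous_id))).integrable_of_hasCompactSupport
          φ.hasCompactSupport_normed.mul_right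
    have hcφ : Integrable fun t => φ.normed volume t * polarNorm F h :=
      φ.integrable_normed.mul_const _
    have hfx : ∀ x, f x = ∫ t, φ.normed volume t * d (x - t) := fun x => rfl
    calc f (x + h) = ∫ t, φ.normed volume t * d (x + h - t) := hfx _
      _ ≤ ∫ t, (φ.normed volume t * d (x - t) + φ.normed volume t * polarNorm F h) := by
          refine integral_mono (hint _) ((hint x).add hcφ) fun t => ?_
          have h1 := hF.anisoDist_le_add hne (x + h - t) (x - t)
          have h2 : x + h - t - (x - t) = h := by abel
          rw [h2] at h1
          have h3 := mul_le_mul_of_nonneg_left h1 (φ.nonneg_normed (μ := volume) t)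
          rwa [mul_add] at h3
      _ = f x + polarNorm F h := by
          rw [integral_add (hint x) hcφ, integral_mul_const, φ.integral_normed, one_mul, hfx]

/-- The Rayleigh quotient of `exp (-t f)`, where `f` is a smooth function within `ε` of the
anisotropic distance to the boundary. -/
theorem IsBoundedC2Domain.firstRobinEigenvalue_le_of_pos (hΩ : IsBoundedC2Domain Ω)
    (hF : IsFinslerNorm p F) (hp : 1 < p) (hN : 0 < N)
    (hH : ∀ y ∈ frontier Ω, 0 ≤ anisotropicMeanCurvature F Ω y) {t ε : ℝ} (ht : 0 < t)
    (hε : 0 < ε) :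
    firstRobinEigenvalue p (-t ^ (p - 1)) F Ω ≤
      ((t ^ p * (1 - p * Real.exp (-2 * (p * t * ε))) : ℝ) : EReal) := by
  have hp0 : 0 < p := by linarith
  obtain ⟨f, hf, hfd, hfF⟩ :=
    hF.exists_contDiff_approx_anisoDist (Ω := Ω) (hΩ.nonempty_compl hN) hε
  set d := anisoDist F Ω with hd
  set u : EuclideanSpace ℝ (Fin N) → ℝ := fun x => Real.exp (-t * f x) with hu
  have hus : ContDiff ℝ ∞ u := Real.contDiff_exp.comp (contDiff_const.mul hf)
  have hupos : ∀ x, 0 < u x := fun x => Real.exp_pos _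
  have hup : ∀ x, |u x| ^ p = Real.exp (-(p * t) * f x) := fun x => by
    rw [abs_of_pos (hupos x), hu, ← Real.exp_mul]
    congr 1
    ring
  have hupc : Continuous fun x => |u x| ^ p :=
    hus.continuous.abs.rpow_const fun x => Or.inr hp0.le
  have hgrad : ∀ x, gradient u x = (-(t * u x)) • gradient f x := fun x => by
    have h1 : HasGradientAt u ((-(t * u x)) • gradient f x) x := by
      rw [hasGradientAt_iff_hasFDerivAt]
      refine (((hf.differentiable (by simp) x).hasFDerivAt.const_mul (-t)).exp).congr_fderiv ?_
      rw [map_smulₛₗ, toDual_gradient, smul_smul]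
      congr 1
      simp only [hu, conj_trivial]
      ring
    exact h1.gradient
  set D := ∫ x in Ω, |u x| ^ p with hD
  have hDint : IntegrableOn (fun x => |u x| ^ p) Ω :=
    memLp_one_iff_integrable.mp (memLp_restrict_of_continuous hΩ.isBounded hΩ.isOpen hupc 1)
  have hDpos : 0 < D := by
    rw [hD, setIntegral_pos_iff_support_of_nonneg_ae
      (Eventually.of_forall fun x => by simp only [Pi.zero_apply]; positivity) hDint]
    have hsupp : (Function.support fun x => |u x| ^ p) = univ :=
      Function.support_eq_univ fun x => (Real.rpow_pos_of_pos (abs_pos.mpr (hupos x).ne') p).ne'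
    rw [hsupp, univ_inter]
    exact hΩ.isOpen.measure_pos _ hΩ.isConnected.nonempty
  set P := ∫ z, F (outerNormal Ω z) ∂surfaceMeasure Ω with hP
  have hPint : Integrable (fun z => F (outerNormal Ω z)) (surfaceMeasure Ω) := by
    simpa using hΩ.integrable_mul_outerNormal hF (continuous_const (y := (1 : ℝ)))
  have hP0 : 0 ≤ P := integral_nonneg fun z => hF.nonneg _
  have hgradient_bound : ∫ x in Ω, F (gradient u x) ^ p ≤ t ^ p * D := by
    rw [hD, ← integral_const_mul]
    refine integral_mono_of_nonneg (Eventually.of_forall fun x => Real.rpow_nonneg (hF.nonneg _) p)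
      (hDint.const_mul _) (Eventually.of_forall fun x => ?_)
    simp only
    rw [hgrad, hF.homogeneous, abs_neg, abs_mul, abs_of_pos ht,
      ← Real.mul_rpow ht.le (abs_nonneg _)]
    exact Real.rpow_le_rpow (mul_nonneg (by positivity) (hF.nonneg _))
      (mul_le_of_le_one_right (by positivity) (hfF x)) hp0.le
  have hboundary : Real.exp (-(p * t * ε)) * P ≤
      ∫ z, |u z| ^ p * F (outerNormal Ω z) ∂surfaceMeasure Ω := by
    rw [hP, ← integral_const_mul]
    refine integral_mono_ae (hPint.const_mul _) (hΩ.integrable_mul_outerNormal hF hupc) ?_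
    refine (ae_restrict_iff' isClosed_frontier.measurableSet).mpr (Eventually.of_forall ?_)
    intro z hz
    refine mul_le_mul_of_nonneg_right ?_ (hF.nonneg _)
    rw [hup, Real.exp_le_exp]
    have h1 : d z = 0 := by
      rw [hΩ.isOpen.frontier_eq] at hz
      exact hF.anisoDist_eq_zero hz.2
    have h2 := (abs_le.mp (hfd z)).2
    rw [h1, sub_zero] at h2
    nlinarith [mul_pos hp0 ht]
  have hvolume : D ≤ Real.exp (p * t * ε) * (1 / (p * t) * P) := by
    have h1 := hΩ.lintegral_exp_anisoDist_le hF hN hH (mul_pos hp0 ht)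
    rw [← ofReal_integral_eq_lintegral_ofReal hPint (Eventually.of_forall fun z => hF.nonneg _),
      ← ENNReal.ofReal_mul (by positivity)] at h1
    rw [← ENNReal.ofReal_le_ofReal_iff (by positivity), hD, ofReal_integral_eq_lintegral_ofReal hDint
      (Eventually.of_forall fun x => by simp only [Pi.zero_apply]; positivity),
      ENNReal.ofReal_mul (by positivity)]
    refine le_trans ?_ (mul_le_mul_right h1 _)
    rw [← lintegral_const_mul' _ _ ENNReal.ofReal_ne_top]
    refine lintegral_mono fun x => ?_
    rw [← ENNReal.ofReal_mul (by positivity), hup, ← Real.exp_add]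
    refine ENNReal.ofReal_le_ofReal (Real.exp_le_exp.mpr ?_)
    have h2 := (abs_le.mp (hfd x)).1
    nlinarith [mul_pos hp0 ht]
  have hfinite : IsFiniteMeasure (surfaceMeasure Ω) := ⟨hΩ.surfaceMeasure_lt_top hF⟩
  have hmem : MemLp u (ENNReal.ofReal p) (surfaceMeasure Ω) := by
    obtain ⟨C, hC⟩ := hΩ.isCompact_frontier.exists_bound_of_continuousOn hus.continuous.continuousOn
    exact MemLp.of_bound hus.continuous.aestronglyMeasurable C
      ((ae_restrict_iff' isClosed_frontier.measurableSet).mpr (Eventually.of_forall hC))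
  have hle : rayleighQuotient p (-t ^ (p - 1)) F Ω u (gradient u) u ≤
      t ^ p * (1 - p * Real.exp (-2 * (p * t * ε))) := by
    rw [rayleighQuotient, div_le_iff₀ hDpos]
    have htp : t ^ p = t ^ (p - 1) * t := by
      rw [← Real.rpow_add_one ht.ne', sub_add_cancel]
    have hT : 0 < t ^ (p - 1) := Real.rpow_pos_of_pos ht _
    have hP' : p * t * Real.exp (-(p * t * ε)) * D ≤ P := by
      have h1 := mul_le_mul_of_nonneg_left hvolume
        (by positivity : 0 ≤ p * t * Real.exp (-(p * t * ε)))
      have h2 : Real.exp (-(p * t * ε)) * Real.exp (p * t * ε) = 1 := by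
        rw [← Real.exp_add, neg_add_cancel, Real.exp_zero]
      refine h1.trans_eq ?_
      calc p * t * Real.exp (-(p * t * ε)) * (Real.exp (p * t * ε) * (1 / (p * t) * P))
          = (Real.exp (-(p * t * ε)) * Real.exp (p * t * ε)) * (p * t * (1 / (p * t))) * P := by
            ring
        _ = P := by rw [h2, mul_one_div_cancel (by positivity), one_mul, one_mul]
    have hB : p * t * Real.exp (-2 * (p * t * ε)) * D ≤
        ∫ z, |u z| ^ p * F (outerNormal Ω z) ∂surfaceMeasure Ω := by
      refine le_trans ?_ hboundary
      have h3 := mul_le_mul_of_nonneg_left hP' (Real.exp_pos (-(p * t * ε))).le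
      refine le_trans (le_of_eq ?_) h3
      have h4 : Real.exp (-2 * (p * t * ε)) =
          Real.exp (-(p * t * ε)) * Real.exp (-(p * t * ε)) := by
        rw [← Real.exp_add]
        congr 1
        ring
      rw [h4]
      ring
    have h5 := mul_le_mul_of_nonneg_left hB hT.le
    rw [htp] at hgradient_bound ⊢
    linarith
  have hadm : firstRobinEigenvalue p (-t ^ (p - 1)) F Ω ≤
      ((rayleighQuotient p (-t ^ (p - 1)) F Ω u (gradient u) u : ℝ) : EReal) := by
    refine sInf_le ⟨u, gradient u, u, isSobolev_of_contDiff hΩ.isBounded hΩ.isOpen hus,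
      isTrace_of_contDiff hus hmem, fun h => ?_, rfl⟩
    have h1 : ∀ᵐ x ∂(volume.restrict Ω), False := h.mono fun x hx => (hupos x).ne' hx
    rw [eventually_false_iff_eq_bot, ae_eq_bot, Measure.restrict_eq_zero] at h1
    exact (hΩ.isOpen.measure_pos volume hΩ.isConnected.nonempty).ne' h1
  exact hadm.trans (EReal.coe_le_coe_iff.mpr hle)

end TestFunction

end RobinFinsler

end

theorem corollary1p5 {N : ℕ} (hN : 2 ≤ N) (p : ℝ) (hp : 1 < p)
    (F : EuclideanSpace ℝ (Fin N) → ℝ) (hF : RobinFinsler.IsFinslerNorm p F)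
    (Ω : Set (EuclideanSpace ℝ (Fin N))) (hΩ : RobinFinsler.IsBoundedC2Domain Ω)
    (hH : ∀ y ∈ frontier Ω, 0 ≤ RobinFinsler.anisotropicMeanCurvature F Ω y)
    (β : ℝ) (hβ : β < 0) :
    RobinFinsler.firstRobinEigenvalue p β F Ω ≤
      (((1 - p) * |β| ^ (p / (p - 1)) : ℝ) : EReal) := by
  have hβ' : 0 < |β| := abs_pos.mpr hβ.ne
  have hp1 : p - 1 ≠ 0 := by linarith
  set t : ℝ := |β| ^ (1 / (p - 1)) with ht
  have htpos : 0 < t := Real.rpow_pos_of_pos hβ' _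
  have h1 : -t ^ (p - 1) = β := by
    rw [ht, ← Real.rpow_mul hβ'.le, one_div_mul_cancel hp1, Real.rpow_one, abs_of_neg hβ, neg_neg]
  have h2 : t ^ p = |β| ^ (p / (p - 1)) := by
    rw [ht, ← Real.rpow_mul hβ'.le, one_div_mul_eq_div]
  have hc : Continuous fun ε : ℝ => t ^ p * (1 - p * Real.exp (-2 * (p * t * ε))) := by fun_prop
  have hlim : Filter.Tendsto
      (fun ε : ℝ => ((t ^ p * (1 - p * Real.exp (-2 * (p * t * ε))) : ℝ) : EReal))
      (nhdsWithin 0 (Set.Ioi 0)) (nhds (((1 - p) * |β| ^ (p / (p - 1)) : ℝ) : EReal)) := by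
    have h3 := (continuous_coe_real_ereal.comp hc).tendsto 0
    simp only [Function.comp_apply, mul_zero, Real.exp_zero, mul_one] at h3
    rw [mul_comm (1 - p), ← h2]
    exact h3.mono_left nhdsWithin_le_nhds
  refine ge_of_tendsto hlim ?_
  filter_upwards [self_mem_nhdsWithin] with ε hε
  have := hΩ.firstRobinEigenvalue_le_of_pos hF hp (by omega) hH htpos hε
  rwa [h1] at this
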